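/- **Setting.** There are $n$ workers, $n$ data blocks with partial gradients $g_1,\dots,g_n$, and $s=\delta n$ stragglers, $0<\delta<1$. Put $b=\lceil 1/\log(1/\delta)\rceil+1$ and $m=\lfloor n/b\rfloor$, and divide the data blocks into $m$ consecutive batches of sizes $\lfloor n/m\rfloor$ or $\lceil n/m\rceil$ (all of size $b$ if $b\mid n$). Let $0<\varepsilon<1/4$, $D=\lfloor 1/\varepsilon\rfloor$, $u=2\varepsilon(1-2\varepsilon)/(1-4\varepsilon)^2$, and let $P_w$ be the degree distribution $$p_1=\frac{u}{u+1},\qquad p_k=\frac{1}{k(k-1)(u+1)}\ (2\le k\le D),\qquad p_{D+1}=\frac{1}{D(u+1)} .$$ In the $(b,P_w)$-batch raptor code, defined when $D+1\le m$, each worker independently draws a degree $d$ from $P_w$ and then a uniformly random set of $d$ of the $m$ batches, and returns the sum of the partial gradients in these batches. So its row in the coding matrix $A\in\{0,1\}^{n\times n}$ is the indicator vector of the data blocks in these batches. A uniformly random set $S$ of $n-s$ workers, independent of $A$, is received, and $A_S$ denotes the corresponding row submatrix. The *peeling decoder* repeatedly picks a received row in which exactly one batch remains, adds its current result to the gradient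 estimate, and subtracts that batch from all received results that contain it. It stops when at least $n(1-\varepsilon)$ partial gradients are recovered or no such row is left. If the estimate is $\sum_j v_jg_j$, its error is $\|v-1_n\|^2$. The recovery error is $\mathrm{err}(A_S)=\min_{w\in\mathbb R^{n-s}}\|A_S^Tw-1_n\|^2$. Call $\varepsilon\in(0,1/4)$ *admissible for* $\delta$ if $\frac{1-2\varepsilon}{1-4\varepsilon}\cdot\frac nb<n-s$, that is, $\frac{1-2\varepsilon}{1-4\varepsilon}<b(1-\delta)$. **Theorem.** 1. For every $\delta\in(0,1)$ there is $\varepsilon_0>0$ such that every $\varepsilon\in(0,\varepsilon_0)$ is less than $1/4$ and admissible for $\delta$. 2. For every $\varepsilon\in(0,1/4)$ there is $c_0>0$ such that for all integers $0<s<n$, with $\delta=s/n$, for which $\varepsilon$ is admissible for $\delta$ and $D+1\le m$, the probability that some run of the peeling decoder (for some choice of the rows picked) stops with an error exceeding $\varepsilon n$ is less than $e^{-c_0n}$, and $$\mathbb P\big(\mathrm{err}(A_S)>\varepsilon n\big)<e^{-c_0 n}.$$ 3. The average computation load is $O\big(\log(1/\varepsilon)/\log(1/\delta)\big)$ for $\delta$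 bounded away from $0$: for every $\delta_0\in(0,1)$ there is $C>0$ such that for all $\varepsilon\in(0,1/4)$ and all integers $0<s<n$ with $\delta=s/n\ge\delta_0$ and $D+1\le m$, $$\mathbb E\Big[\frac1n\sum_{k=1}^n\|a_k\|_0\Big]\le C\,\frac{\log(1/\varepsilon)}{\log(1/\delta)},$$ where $a_k$ is the $k$-th row of $A$ and $\|a_k\|_0$ is its number of nonzero entries. -/

import Mathlib

open MeasureTheory

noncomputable section

namespace BatchRaptor

/-- The batch size `b = ⌈1 / log (1/δ)⌉ + 1`. -/
def batchSize (δ : ℝ) : ℕ := ⌈1 / Real.log (1 / δ)⌉₊ + 1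

/-- The `i`-th of `m` consecutive batches of the `n` data blocks. Every batch has `⌊n/m⌋` or
`⌈n/m⌉` elements; if `n = b * m`, the `i`-th batch is `{j | i * b ≤ j < (i + 1) * b}`. -/
def batch (n m : ℕ) (i : Fin m) : Finset (Fin n) :=
  Finset.univ.filter fun j => (j : ℕ) * m / n = (i : ℕ)

/-- The coding matrix of a batch code, where worker `k` computes the sum of the partial gradients
in the batches with index in `I k`. -/
def codingMatrix {n m : ℕ} (I : Fin n → Finset (Fin m)) : Matrix (Fin n) (Fin n) ℝ :=
  Matrix.of fun k j => if j ∈ (I k).biUnion (batch n m) then 1 else 0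

/-- The row submatrix `A_S`. -/
def rowSubmatrix {n : ℕ} (A : Matrix (Fin n) (Fin n) ℝ) (S : Finset (Fin n)) :
    Matrix S (Fin n) ℝ :=
  A.submatrix (fun i : S => (i : Fin n)) id

/-- The squared Euclidean distance of `v` from the all-one vector. -/
def distOne {n : ℕ} (v : Fin n → ℝ) : ℝ := ∑ j, (v j - 1) ^ 2

/-- The recovery error `min_u ‖A_Sᵀ u - 1‖²`. -/
def err {n : ℕ} (A : Matrix (Fin n) (Fin n) ℝ) (S : Finset (Fin n)) : ℝ :=
  ⨅ u : S → ℝ, distOne ((rowSubmatrix A S).transpose.mulVec u)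

/-- The computation load averaged over the workers, `(1/n) ∑ₖ ‖aₖ‖₀`. -/
def averageLoad {n : ℕ} (A : Matrix (Fin n) (Fin n) ℝ) : ℝ :=
  (∑ k, ((Finset.univ.filter fun j => A k j ≠ 0).card : ℝ)) / n

/-! ### The random code -/

/-- The maximal regular degree `D = ⌊1/ε⌋`. -/
def maxDeg (ε : ℝ) : ℕ := ⌊1 / ε⌋₊

/-- `u = 2ε(1 - 2ε) / (1 - 4ε)²`. -/
def solitonU (ε : ℝ) : ℝ := 2 * ε * (1 - 2 * ε) / (1 - 4 * ε) ^ 2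

/-- The probability `p_k` of the degree `k` under `P_w`. -/
def solitonWeight (ε : ℝ) (k : ℕ) : ℝ :=
  if k = 1 then solitonU ε / (solitonU ε + 1)
  else if k = maxDeg ε + 1 then 1 / (maxDeg ε * (solitonU ε + 1))
  else if 2 ≤ k ∧ k ≤ maxDeg ε then 1 / (k * (k - 1) * (solitonU ε + 1))
  else 0

theorem solitonU_nonneg {ε : ℝ} (h0 : 0 < ε) (h4 : ε < 1 / 4) : 0 ≤ solitonU ε := by
  unfold solitonU
  have : 0 < 1 - 2 * ε := by linarith
  positivity

theorem four_le_maxDeg {ε : ℝ} (h0 : 0 < ε) (h4 : ε < 1 / 4) : 4 ≤ maxDeg ε := by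
  unfold maxDeg
  apply Nat.le_floor
  rw [le_div_iff₀ h0]
  push_cast
  linarith

theorem solitonWeight_nonneg {ε : ℝ} (h0 : 0 < ε) (h4 : ε < 1 / 4) (k : ℕ) :
    0 ≤ solitonWeight ε k := by
  have hu := solitonU_nonneg h0 h4
  unfold solitonWeight
  split_ifs with h1 h2 h3
  · positivity
  · positivity
  · have : (2 : ℝ) ≤ k := by exact_mod_cast h3.1
    have : (0 : ℝ) ≤ (k : ℝ) - 1 := by linarith
    positivity
  · exact le_rfl

theorem sum_telescope (D : ℕ) (hD : 1 ≤ D) :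
    ∑ k ∈ Finset.range (D - 1), 1 / (((k : ℝ) + 2) * ((k : ℝ) + 1)) = 1 - 1 / D := by
  obtain ⟨E, rfl⟩ : ∃ E, D = E + 1 := ⟨D - 1, by omega⟩
  rw [Nat.add_sub_cancel]
  clear hD
  induction E with
  | zero => simp
  | succ E ih =>
    rw [Finset.sum_range_succ, ih]
    push_cast
    field_simp
    ring

theorem sum_solitonWeight {ε : ℝ} (h0 : 0 < ε) (h4 : ε < 1 / 4) {m : ℕ}
    (hm : maxDeg ε + 1 ≤ m) :
    ∑ d : Fin m, solitonWeight ε ((d : ℕ) + 1) = 1 := by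
  have hu := solitonU_nonneg h0 h4
  have hD := four_le_maxDeg h0 h4
  rw [Fin.sum_univ_eq_sum_range (fun d => solitonWeight ε (d + 1)) m]
  rw [← Finset.sum_subset (Finset.range_subset_range.2 hm)]
  · obtain ⟨E, hE⟩ : ∃ E, maxDeg ε = E + 1 := ⟨maxDeg ε - 1, by omega⟩
    rw [Finset.sum_range_succ, hE, Finset.sum_range_succ']
    have h1 : ∀ k ∈ Finset.range E, solitonWeight ε (k + 1 + 1)
        = 1 / (((k : ℝ) + 2) * ((k : ℝ) + 1)) * (1 / (solitonU ε + 1)) := by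
      intro k hk
      rw [Finset.mem_range] at hk
      unfold solitonWeight
      rw [if_neg (by omega), if_neg (by omega), if_pos (by omega)]
      push_cast
      rw [show (k : ℝ) + 1 + 1 - 1 = k + 1 by ring, show (k : ℝ) + 1 + 1 = k + 2 by ring,
        one_div_mul_one_div]
    rw [Finset.sum_congr rfl h1, ← Finset.sum_mul]
    have h2 := sum_telescope (E + 1) (by omega)
    rw [Nat.add_sub_cancel] at h2
    rw [h2]
    have h3 : solitonWeight ε (0 + 1) = solitonU ε / (solitonU ε + 1) := by
      simp [solitonWeight]
    have h4' : solitonWeight ε (E + 1 + 1) = 1 / (((E + 1 : ℕ) : ℝ) * (solitonU ε + 1)) := by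
      unfold solitonWeight
      rw [if_neg (by omega), if_pos (by omega), hE]
    rw [h3, h4']
    push_cast
    have : (E : ℝ) + 1 ≠ 0 := by positivity
    have : solitonU ε + 1 ≠ 0 := by positivity
    field_simp
    ring
  · intro d _ hd
    rw [Finset.mem_range] at hd
    unfold solitonWeight
    rw [if_neg (by omega), if_neg (by omega), if_neg (by omega)]

/-- The degree distribution `P_w` on the degrees `1, …, m`; the element `d : Fin m` stands for the
degree `d + 1`. -/
def solitonPMF (m : ℕ) (ε : ℝ) (h0 : 0 < ε) (h4 : ε < 1 / 4) (hm : maxDeg ε + 1 ≤ m) :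
    PMF (Fin m) :=
  PMF.ofFintype (fun d => ENNReal.ofReal (solitonWeight ε ((d : ℕ) + 1))) (by
    rw [← ENNReal.ofReal_sum_of_nonneg fun _ _ => solitonWeight_nonneg h0 h4 _,
      sum_solitonWeight h0 h4 hm, ENNReal.ofReal_one])

/-- A uniformly random subset of `Fin m` with `d` elements. -/
def uniformSubset (m d : ℕ) (hd : d ≤ m) : PMF (Finset (Fin m)) :=
  PMF.uniformOfFinset (Finset.powersetCard d Finset.univ)
    (Finset.powersetCard_nonempty.2 (by simpa using hd))

/-- The batches stored by one worker: draw a degree `d` from `P`, then a uniformly random set of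
`d` of the `m` batches. -/
def workerPMF {m : ℕ} (P : PMF (Fin m)) : PMF (Finset (Fin m)) :=
  P.bind fun d => uniformSubset m ((d : ℕ) + 1) d.isLt

/-- The random code: the `n` workers draw their batches independently. -/
def codeLaw (n : ℕ) {m : ℕ} (P : PMF (Fin m)) : Measure (Fin n → Finset (Fin m)) :=
  Measure.pi fun _ => (workerPMF P).toMeasure

/-- The joint law of the random code and of the independent, uniformly random set `S` of the
`n - s` workers that are not stragglers. -/
def codeStragglerLaw (n s : ℕ) {m : ℕ} (P : PMF (Fin m)) :
    Measure ((Fin n → Finset (Fin m)) × Finset (Fin n)) :=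
  (codeLaw n P).prod (uniformSubset n (n - s) (Nat.sub_le n s)).toMeasure

/-! ### The peeling decoder -/

/-- A state of the decoder, with received results indexed by `S`. Linear combinations of the
partial gradients `g₁, …, gₙ` are represented by their coefficient vectors. -/
structure PeelState (n m : ℕ) (S : Finset (Fin n)) where
  /-- the remaining received coding matrix, over the batches -/
  M : Matrix S (Fin m) ℝ
  /-- the current results `g̃ₖ` -/
  res : S → Fin n → ℝ
  /-- the current estimate `g` of the gradient -/
  grad : Fin n → ℝ
  /-- the batches recovered so far -/
  recovered : Finset (Fin m)

/-- The initial state of the decoder. -/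
def PeelState.init {n m : ℕ} (I : Fin n → Finset (Fin m)) (S : Finset (Fin n)) :
    PeelState n m S where
  M := Matrix.of fun k i => if i ∈ I k then 1 else 0
  res := rowSubmatrix (codingMatrix I) S
  grad := 0
  recovered := ∅

/-- One step: a received row `i` whose only nonzero entry is in column `k₀` yields the batch `k₀`;
its result is added to the gradient estimate and subtracted from all results containing it. -/
def PeelStep {n m : ℕ} {S : Finset (Fin n)} (st st' : PeelState n m S) : Prop :=
  ∃ (i : S) (k₀ : Fin m), st.M i k₀ ≠ 0 ∧ (∀ k, k ≠ k₀ → st.M i k = 0) ∧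
    st' =
      { M := Matrix.of fun k l => if l = k₀ then 0 else st.M k l
        res := fun k => st.res k - st.M k k₀ • st.res i
        grad := st.grad + st.res i
        recovered := insert k₀ st.recovered }

/-- The decoder stops when at least `n(1 - ε)` partial gradients are recovered, or when no row
with exactly one nonzero entry is left. -/
def PeelState.Halted {n m : ℕ} {S : Finset (Fin n)} (ε : ℝ) (st : PeelState n m S) : Prop :=
  (n : ℝ) * (1 - ε) ≤ ((st.recovered.biUnion (batch n m)).card : ℝ) ∨ ¬ ∃ st', PeelStep st st'

/-- Some run of the decoder (some choice of rows) stops with a gradient estimate whose error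
`‖v - 1‖²` exceeds `c`, where `v` is the coefficient vector of the estimate. -/
def PeelErrorExceeds {n m : ℕ} (ε c : ℝ) (I : Fin n → Finset (Fin m)) (S : Finset (Fin n)) :
    Prop :=
  ∃ st : PeelState n m S,
    Relation.ReflTransGen PeelStep (PeelState.init I S) st ∧ st.Halted ε ∧ c < distOne st.grad

end BatchRaptor

end

/-! The final set of a peeling run without early stopping does not depend on the order, because a
set at which nothing can be peeled contains every set reached by peeling (`peelSet_subset`). In
every decoder state the estimate is the indicator of the recovered blocks and lies in the row space
of the received matrix. So an error above `ε n`, of a run or of `err`, forces one canonical process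
`peelSet` to get stuck at some size `t` with `b t < n (1 - ε)`.

The core is a bound on the probability of getting stuck at exactly `t` of the `m` batches, for a
fixed set of `N` received rows. Fix a set `W` of batches. As long as the process avoids `W`, a row
with at least two unprocessed batches has revealed nothing else. The current set `R` is compared
with a completion of it to `t` batches outside `W`. Replacing one completion by another does not
change the conditional weight of "no row hits `W`", so this weight gives a supermartingale, and
avoiding `W` up to time `t` has probability at most `(1 - |W| q) ^ N`, where `q = hitProb ω t`
(`sum_avoid_le`). A process stuck at `t` avoids every subset of its complement. Summing over all `W`
with weight `θ ^ |W|` gives `P(stuck at t) (1 + θ) ^ (m - t) ≤ (1 + θ exp (-N q)) ^ m`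
(`sum_stuck_le`). This is exponentially small as soon as `m exp (-N q)` is below `m - t` by a linear
margin.

The margin is density evolution. For large `m`, `m q` is nearly the derivative of the degree
generating function at `t / m`, and the soliton weights make `overhead ε` times this derivative
exceed `-log (1 - y)` by a constant on `[0, 1 - ε]` (`exists_margin`). Admissibility provides
`overhead ε * m` rows and also bounds the batch size, so decay in `m` is decay in `n`. Bounded `n`
are handled by an explicit good code of positive probability. The load is the mean degree, of order
`log (1 / ε)`, times the batch size, of order `1 / log (1 / δ)`. -/

open MeasureTheory

noncomputable section

namespace BatchRaptor

/-! ### Peeling as a process on sets of batches -/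

section Peeling

variable {ι α : Type*} [DecidableEq α]

/-- The element left of `x` outside `R` is unique and lies in `W`. -/
def Hits (W R x : Finset α) : Prop := ∃ i ∈ W, x \ R = {i}

/-- What is known about a row `x` once the batches in `R` are processed: the row itself if at most
one batch remains, nothing otherwise. -/
def view (R x : Finset α) : Option (Finset α) := if (x \ R).card ≤ 1 then some x else none

theorem eq_of_view_eq {R x y : Finset α} (h : view R x = view R y) (hx : (x \ R).card ≤ 1) :
    x = y := by
  unfold view at h
  rw [if_pos hx] at h
  split_ifs at h
  exact Option.some.inj h

/-- A single remaining batch that lies in `W` cannot be absorbed by `T`, which avoids `W`. So the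
choice of `T` is irrelevant for the rows that are already visible at `R`. -/
theorem hits_iff_of_card_le_one {W R T x : Finset α} (hRT : R ⊆ T) (hT : Disjoint T W)
    (hx : (x \ R).card ≤ 1) : Hits W T x ↔ Hits W R x := by
  have hsub : x \ T ⊆ x \ R := Finset.sdiff_subset_sdiff le_rfl hRT
  constructor
  · rintro ⟨i, hi, h⟩
    refine ⟨i, hi, ?_⟩
    rw [← h]
    exact (Finset.eq_of_subset_of_card_le hsub (by rw [h]; simpa using hx)).symm
  · rintro ⟨i, hi, h⟩
    refine ⟨i, hi, ?_⟩
    have hiT : i ∉ T := fun hT' => Finset.disjoint_left.1 hT hT' hi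
    have hix : i ∈ x \ R := by simp [h]
    apply Finset.Subset.antisymm (h ▸ hsub)
    simpa [hiT] using (Finset.mem_sdiff.1 hix).1

/-- Add some element of `X` to `R`, if there is one. -/
def grow (X R : Finset α) : Finset α :=
  open Classical in if h : X.Nonempty then insert h.choose R else R

theorem subset_grow (X R : Finset α) : R ⊆ grow X R := by
  unfold grow
  split_ifs
  · exact Finset.subset_insert _ _
  · exact le_rfl

theorem card_grow_le (X R : Finset α) : (grow X R).card ≤ R.card + 1 := by
  unfold grow
  split_ifs
  · exact Finset.card_insert_le _ _
  · omega

theorem grow_subset {X R T : Finset α} (hX : X ⊆ T) (hR : R ⊆ T) : grow X R ⊆ T := by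
  unfold grow
  split_ifs with h
  · exact Finset.insert_subset (hX h.choose_spec) hR
  · exact hR

variable [Fintype α]

open Classical in
/-- The batches that can be peeled next once the batches in `R` are processed. -/
def ripple (S : Finset ι) (I : ι → Finset α) (R : Finset α) : Finset α :=
  Finset.univ.filter fun c => ∃ k ∈ S, I k \ R = {c}

theorem mem_ripple {S : Finset ι} {I : ι → Finset α} {R : Finset α} {c : α} :
    c ∈ ripple S I R ↔ ∃ k ∈ S, I k \ R = {c} := by
  simp [ripple]

theorem notMem_of_mem_ripple {S : Finset ι} {I : ι → Finset α} {R : Finset α} {c : α}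
    (h : c ∈ ripple S I R) : c ∉ R := by
  obtain ⟨k, -, hk⟩ := mem_ripple.1 h
  have : c ∈ I k \ R := by simp [hk]
  exact (Finset.mem_sdiff.1 this).2

/-- The batches processed in the first `t` steps of a run of the peeling process. -/
def peelSet (S : Finset ι) (I : ι → Finset α) : ℕ → Finset α
  | 0 => ∅
  | t + 1 => grow (ripple S I (peelSet S I t)) (peelSet S I t)

theorem peelSet_mono (S : Finset ι) (I : ι → Finset α) : Monotone (peelSet S I) :=
  monotone_nat_of_le_succ fun _ => subset_grow _ _

theorem card_peelSet_le (S : Finset ι) (I : ι → Finset α) (t : ℕ) :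
    (peelSet S I t).card ≤ t := by
  induction t with
  | zero => simp [peelSet]
  | succ t ih => exact (card_grow_le _ _).trans (by omega)

theorem card_peelSet_eq {S : Finset ι} {I : ι → Finset α} {t : ℕ}
    (h : ∀ s < t, (ripple S I (peelSet S I s)).Nonempty) : (peelSet S I t).card = t := by
  induction t with
  | zero => simp [peelSet]
  | succ t ih =>
    have hne := h t (by omega)
    rw [peelSet, grow, dif_pos hne,
      Finset.card_insert_of_notMem (notMem_of_mem_ripple hne.choose_spec),
      ih fun s hs => h s (by omega)]

/-- The peeling process gets stuck after as many steps as it has processed batches. -/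
theorem exists_ripple_eq_empty (S : Finset ι) (I : ι → Finset α) :
    ∃ t, ripple S I (peelSet S I t) = ∅ ∧ (peelSet S I t).card = t := by
  classical
  have hex : ∃ t, ripple S I (peelSet S I t) = ∅ := by
    by_contra! h
    have h1 := card_peelSet_eq (t := Fintype.card α + 1) fun s _ => h s
    have h2 := Finset.card_le_univ (peelSet S I (Fintype.card α + 1))
    omega
  refine ⟨Nat.find hex, Nat.find_spec hex, card_peelSet_eq fun s hs => ?_⟩
  exact Finset.nonempty_iff_ne_empty.2 (Nat.find_min hex hs)

/-- A set of batches at which no row can be peeled contains all batches ever processed. -/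
theorem peelSet_subset {S : Finset ι} {I : ι → Finset α} {T : Finset α}
    (hT : ripple S I T = ∅) (t : ℕ) : peelSet S I t ⊆ T := by
  induction t with
  | zero => simp [peelSet]
  | succ t ih =>
    refine grow_subset (fun c hc => ?_) ih
    obtain ⟨k, hkS, hk⟩ := mem_ripple.1 hc
    by_contra hcT
    have : c ∈ ripple S I T := by
      refine mem_ripple.2 ⟨k, hkS, Finset.Subset.antisymm ?_ ?_⟩
      · rw [← hk]
        exact Finset.sdiff_subset_sdiff le_rfl ih
      · have : c ∈ I k \ peelSet S I t := by simp [hk]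
        simpa [hcT] using (Finset.mem_sdiff.1 this).1
    simp [hT] at this

/-- A row that can be peeled at `T` has at most one batch outside the larger set `R`, so its view at
`R` is the full row. -/
theorem ripple_congr {S : Finset ι} {I J : ι → Finset α} {R T : Finset α} (hTR : T ⊆ R)
    (h : ∀ k, view R (I k) = view R (J k)) : ripple S I T = ripple S J T := by
  have key : ∀ {I J : ι → Finset α}, (∀ k, view R (I k) = view R (J k)) →
      ripple S I T ⊆ ripple S J T := by
    intro I J h c hc
    obtain ⟨k, hkS, hk⟩ := mem_ripple.1 hc
    have hcard : (I k \ R).card ≤ 1 := by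
      refine (Finset.card_le_card (Finset.sdiff_subset_sdiff le_rfl hTR)).trans ?_
      simp [hk]
    exact mem_ripple.2 ⟨k, hkS, by rw [← eq_of_view_eq (h k) hcard, hk]⟩
  exact Finset.Subset.antisymm (key h) (key fun k => (h k).symm)

theorem peelSet_congr {S : Finset ι} {I J : ι → Finset α} {s : ℕ}
    (h : ∀ k, view (peelSet S I s) (I k) = view (peelSet S I s) (J k)) {r : ℕ} (hr : r ≤ s + 1) :
    peelSet S J r = peelSet S I r := by
  induction r with
  | zero => rfl
  | succ r ih =>
    -- `grow` picks its element as a function of the ripple alone, so equal ripples give equal next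
    -- sets. Hence the views at step `s` determine even step `s + 1`.
    rw [peelSet, peelSet, ih (by omega),
      ripple_congr (peelSet_mono S I (show r ≤ s by omega)) h]

end Peeling

/-! ### Independent rows -/

section Rows

/-- Independent coordinates may be replaced inside the fibres of a function on which everything
else depends. -/
theorem sum_mul_prod_congr_of_fiber {ι X Y : Type*} [Fintype ι] [DecidableEq ι] [Fintype X]
    [Fintype Y] [DecidableEq Y] (r : X → Y) (c d : ι → X → ℝ)
    (h : ∀ k y, ∑ x with r x = y, c k x = ∑ x with r x = y, d k x) (g : (ι → X) → ℝ)
    (hg : ∀ I J : ι → X, (∀ k, r (I k) = r (J k)) → g I = g J) :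
    ∑ I : ι → X, g I * ∏ k, c k (I k) = ∑ I : ι → X, g I * ∏ k, d k (I k) := by
  classical
  have key : ∀ (c : ι → X → ℝ) (J : ι → Y) (I₀ : ι → X), (fun k => r (I₀ k)) = J →
      ∑ I : ι → X with (fun k => r (I k)) = J, g I * ∏ k, c k (I k)
        = g I₀ * ∏ k, ∑ x with r x = J k, c k x := by
    intro c J I₀ h0
    rw [Finset.prod_univ_sum, Finset.mul_sum]
    refine Finset.sum_congr ?_ fun I hI => ?_
    · ext I
      simp [Fintype.mem_piFinset, funext_iff]
    · rw [hg I I₀ fun k => ?_]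
      have := Fintype.mem_piFinset.1 hI k
      rw [(Finset.mem_filter.1 this).2, ← h0]
  rw [← Finset.sum_fiberwise Finset.univ (fun (I : ι → X) k => r (I k)),
    ← Finset.sum_fiberwise Finset.univ (fun (I : ι → X) k => r (I k))
      (fun I => g I * ∏ k, d k (I k))]
  refine Finset.sum_congr rfl fun J _ => ?_
  by_cases hJ : ∃ I₀ : ι → X, (fun k => r (I₀ k)) = J
  · obtain ⟨I₀, h0⟩ := hJ
    rw [key c J I₀ h0, key d J I₀ h0]
    simp only [h]
  · push Not at hJ
    rw [Finset.filter_false_of_mem fun I _ => hJ I, Finset.sum_empty, Finset.sum_empty]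

/-! ### Avoiding a fixed set of batches -/

variable {ι α : Type*} [DecidableEq ι] [DecidableEq α]

/-- The factor of a row in the event that no row in `S` hits `W` once `R` is processed. -/
def missFactor (ω : ℕ → ℝ) (S : Finset ι) (W R : Finset α) (k : ι) (x : Finset α) : ℝ :=
  open Classical in ω x.card * if k ∈ S ∧ Hits W R x then 0 else 1

theorem missFactor_nonneg {ω : ℕ → ℝ} (h0 : ∀ d, 0 ≤ ω d) (S : Finset ι) (W R : Finset α) (k : ι)
    (x : Finset α) : 0 ≤ missFactor ω S W R k x := by
  unfold missFactor
  have := h0 x.card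
  split_ifs <;> simp [this]

variable [Fintype α]

/-- The probability that a random set whose law has the density `ω` in its cardinality consists of
a given point and a subset of a given set with `t` elements. -/
def hitProb (ω : ℕ → ℝ) (t : ℕ) : ℝ := ∑ j ∈ Finset.range (t + 1), (t.choose j : ℝ) * ω (j + 1)

theorem sum_sdiff_eq_singleton (ω : ℕ → ℝ) (R : Finset α) (i : α) (hi : i ∉ R) :
    ∑ x : Finset α with x \ R = {i}, ω x.card = hitProb ω R.card := by
  have h1 := Finset.sum_powerset_apply_card (fun j => ω (j + 1)) (x := R)
  simp only [nsmul_eq_mul] at h1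
  rw [hitProb, ← h1]
  refine Finset.sum_bij' (fun x _ => x.erase i) (fun J _ => insert i J) ?_ ?_ ?_ ?_ ?_
  · intro x hx
    have hx := (Finset.mem_filter.1 hx).2
    rw [Finset.mem_powerset]
    intro a ha
    by_contra haR
    have : a ∈ x \ R := Finset.mem_sdiff.2 ⟨Finset.mem_of_mem_erase ha, haR⟩
    rw [hx, Finset.mem_singleton] at this
    exact Finset.ne_of_mem_erase ha this
  · intro J hJ
    rw [Finset.mem_powerset] at hJ
    simp only [Finset.mem_filter, Finset.mem_univ, true_and]
    rw [Finset.insert_sdiff_of_notMem _ hi, Finset.sdiff_eq_empty_iff_subset.2 hJ]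
    rfl
  · intro x hx
    have hx := (Finset.mem_filter.1 hx).2
    have : i ∈ x \ R := by simp [hx]
    exact Finset.insert_erase (Finset.mem_sdiff.1 this).1
  · intro J hJ
    exact Finset.erase_insert fun h => hi (Finset.mem_powerset.1 hJ h)
  · intro x hx
    have hx := (Finset.mem_filter.1 hx).2
    have : i ∈ x \ R := by simp [hx]
    rw [Finset.card_erase_add_one (Finset.mem_sdiff.1 this).1]

open Classical in
theorem sum_hits (ω : ℕ → ℝ) {W R : Finset α} (h : Disjoint R W) :
    ∑ x : Finset α, ω x.card * (if Hits W R x then 1 else 0) = W.card * hitProb ω R.card := by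
  have h1 : ∀ x : Finset α, (if Hits W R x then (1 : ℝ) else 0)
      = ∑ i ∈ W, if x \ R = {i} then 1 else 0 := by
    intro x
    split_ifs with hx
    · obtain ⟨j, hj, hxj⟩ := hx
      simp only [hxj, Finset.singleton_inj]
      rw [Finset.sum_ite_eq, if_pos hj]
    · refine (Finset.sum_eq_zero fun i hi => if_neg fun hxi => hx ⟨i, hi, hxi⟩).symm
  simp only [h1, Finset.mul_sum]
  rw [Finset.sum_comm, Finset.sum_congr rfl (g := fun _ => hitProb ω R.card), Finset.sum_const,
    nsmul_eq_mul]
  intro i hi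
  rw [← sum_sdiff_eq_singleton ω R i fun hR => Finset.disjoint_left.1 h hR hi, Finset.sum_filter]
  simp

theorem sum_missFactor {ω : ℕ → ℝ} (hω : ∑ x : Finset α, ω x.card = 1) (S : Finset ι)
    {W R : Finset α} (h : Disjoint R W) (k : ι) :
    ∑ x, missFactor ω S W R k x = if k ∈ S then 1 - W.card * hitProb ω R.card else 1 := by
  classical
  unfold missFactor
  split_ifs with hk
  · have e : 1 - W.card * hitProb ω R.card
        = ∑ x : Finset α, ω x.card - W.card * hitProb ω R.card := by rw [hω]
    rw [e, ← sum_hits ω h, ← Finset.sum_sub_distrib]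
    refine Finset.sum_congr rfl fun x _ => ?_
    by_cases hx : Hits W R x <;> simp [hk, hx]
  · simpa [hk] using hω

/-- The exchange step: given what is visible at `R`, the completions `T` and `T'` are equally likely
to be missed. Visible rows do not distinguish them. The hidden rows form one fibre, whose weight is
the total minus the visible part, and the total depends only on the size of the completion. -/
theorem sum_missFactor_fiber {ω : ℕ → ℝ} (hω : ∑ x : Finset α, ω x.card = 1) (S : Finset ι)
    {W R T T' : Finset α} (hT : R ⊆ T) (hT' : R ⊆ T') (hTW : Disjoint T W) (hTW' : Disjoint T' W)
    (hcard : T.card = T'.card) (k : ι) (y : Option (Finset α)) :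
    ∑ x with view R x = y, missFactor ω S W T k x
      = ∑ x with view R x = y, missFactor ω S W T' k x := by
  have hsome : ∀ x, view R x ≠ none → missFactor ω S W T k x = missFactor ω S W T' k x := by
    intro x hx
    have hx1 : (x \ R).card ≤ 1 := by
      by_contra hc
      exact hx (if_neg hc)
    unfold missFactor
    rw [hits_iff_of_card_le_one hT hTW hx1, hits_iff_of_card_le_one hT' hTW' hx1]
  cases y with
  | some z =>
    refine Finset.sum_congr rfl fun x hx => hsome x ?_
    rw [(Finset.mem_filter.1 hx).2]
    simp
  | none =>
    have h1 := Finset.sum_filter_add_sum_filter_not Finset.univ (fun x => view R x = none)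
      (missFactor ω S W T k)
    have h2 := Finset.sum_filter_add_sum_filter_not Finset.univ (fun x => view R x = none)
      (missFactor ω S W T' k)
    have h3 : ∑ x with ¬ view R x = none, missFactor ω S W T k x
        = ∑ x with ¬ view R x = none, missFactor ω S W T' k x :=
      Finset.sum_congr rfl fun x hx => hsome x (Finset.mem_filter.1 hx).2
    have h4 : ∑ x, missFactor ω S W T k x = ∑ x, missFactor ω S W T' k x := by
      rw [sum_missFactor hω S hTW, sum_missFactor hω S hTW', hcard]
    linarith

variable [Fintype ι]

open Classical in
/-- One step of the peeling process does not increase the probability of avoiding `W`, if the rows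
are compared with a completion of the processed set to `t` elements. -/
theorem sum_miss_succ_le {ω : ℕ → ℝ} (h0 : ∀ d, 0 ≤ ω d) (hω : ∑ x : Finset α, ω x.card = 1)
    (S : Finset ι) {W : Finset α} {t : ℕ} {hat : Finset α → Finset α}
    (hhat : ∀ R, Disjoint R W → R.card ≤ t →
      R ⊆ hat R ∧ Disjoint (hat R) W ∧ (hat R).card = t) {s : ℕ} (hs : s < t) :
    ∑ I : ι → Finset α, (if Disjoint (peelSet S I (s + 1)) W then 1 else 0)
        * ∏ k, missFactor ω S W (hat (peelSet S I (s + 1))) k (I k)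
      ≤ ∑ I : ι → Finset α, (if Disjoint (peelSet S I s) W then 1 else 0)
        * ∏ k, missFactor ω S W (hat (peelSet S I s)) k (I k) := by
  -- The indicator that the process is at `R`, moves to `R'` and still avoids `W`. It depends on the
  -- rows only through their views at `R`, so the completion of `R'` can be exchanged for that of
  -- `R`.
  set G : Finset α → Finset α → (ι → Finset α) → ℝ := fun R R' I =>
    if peelSet S I s = R then
      if peelSet S I (s + 1) = R' then if Disjoint R' W then 1 else 0 else 0 else 0 with hG
  have hGcongr : ∀ R R' (I J : ι → Finset α), (∀ k, view R (I k) = view R (J k)) →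
      G R R' I = G R R' J := by
    intro R R' I J h
    by_cases hI : peelSet S I s = R
    · subst hI
      simp only [hG]
      rw [peelSet_congr h (Nat.le_succ s), peelSet_congr h le_rfl]
      simp only [if_true]
    · by_cases hJ : peelSet S J s = R
      · subst hJ
        simp only [hG]
        rw [peelSet_congr (fun k => (h k).symm) (Nat.le_succ s),
          peelSet_congr (fun k => (h k).symm) le_rfl]
        simp only [if_true]
      · simp only [hG, if_neg hI, if_neg hJ]
  have hswap : ∀ R R', ∑ I : ι → Finset α, G R R' I * ∏ k, missFactor ω S W (hat R') k (I k)
      = ∑ I : ι → Finset α, G R R' I * ∏ k, missFactor ω S W (hat R) k (I k) := by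
    intro R R'
    by_cases hc : R ⊆ R' ∧ R.card ≤ t ∧ R'.card ≤ t ∧ Disjoint R' W
    · obtain ⟨hsub, hR, hR', hW⟩ := hc
      obtain ⟨a1, a2, a3⟩ := hhat R (Finset.disjoint_of_subset_left hsub hW) hR
      obtain ⟨b1, b2, b3⟩ := hhat R' hW hR'
      exact sum_mul_prod_congr_of_fiber (view R) _ _
        (sum_missFactor_fiber hω S (hsub.trans b1) a1 b2 a2 (b3.trans a3.symm)) _ (hGcongr R R')
    · have hzero : ∀ I, G R R' I = 0 := by
        intro I
        by_contra hne
        simp only [hG, ite_eq_right_iff, Classical.not_imp] at hne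
        obtain ⟨h1, h2, h3, -⟩ := hne
        refine hc ⟨?_, ?_, ?_, h3⟩
        · rw [← h1, ← h2]
          exact peelSet_mono S I (Nat.le_succ s)
        · rw [← h1]
          exact (card_peelSet_le S I s).trans (by omega)
        · rw [← h2]
          exact (card_peelSet_le S I (s + 1)).trans (by omega)
      simp [hzero]
  have hsplit : ∀ F : Finset α → Finset α → (ι → Finset α) → ℝ,
      ∑ R', ∑ R, ∑ I : ι → Finset α, G R R' I * F R R' I
        = ∑ I : ι → Finset α, (if Disjoint (peelSet S I (s + 1)) W then 1 else 0)
          * F (peelSet S I s) (peelSet S I (s + 1)) I := by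
    intro F
    have h1 : ∀ R', ∑ R, ∑ I : ι → Finset α, G R R' I * F R R' I
        = ∑ I : ι → Finset α, ∑ R, G R R' I * F R R' I := fun R' => Finset.sum_comm
    simp only [h1]
    rw [Finset.sum_comm]
    refine Finset.sum_congr rfl fun I _ => ?_
    simp only [hG, ite_mul, zero_mul, one_mul, Finset.sum_ite_eq, Finset.mem_univ, if_true]
  rw [← hsplit fun R R' I => ∏ k, missFactor ω S W (hat R') k (I k),
    Finset.sum_congr rfl fun R' _ => Finset.sum_congr rfl fun R _ => hswap R R',
    hsplit fun R R' I => ∏ k, missFactor ω S W (hat R) k (I k)]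
  refine Finset.sum_le_sum fun I _ => ?_
  refine mul_le_mul_of_nonneg_right ?_
    (Finset.prod_nonneg fun k _ => missFactor_nonneg h0 _ _ _ _ _)
  split_ifs with h1 h2
  · exact le_rfl
  · exact absurd (Finset.disjoint_of_subset_left (peelSet_mono S I (Nat.le_succ s)) h1) h2
  · exact zero_le_one
  · exact le_rfl

open Classical in
/-- The probability that a fixed set `W` of batches is neither processed nor hit in the first `t`
steps of the peeling process. -/
theorem sum_avoid_le {ω : ℕ → ℝ} (h0 : ∀ d, 0 ≤ ω d) (hω : ∑ x : Finset α, ω x.card = 1)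
    (S : Finset ι) {W : Finset α} {t : ℕ} (hWt : W.card + t ≤ Fintype.card α) :
    ∑ I : ι → Finset α, (∏ k, ω (I k).card) *
        (if (peelSet S I t).card = t ∧ Disjoint (peelSet S I t) W ∧
          ∀ k ∈ S, ¬ Hits W (peelSet S I t) (I k) then 1 else 0)
      ≤ (1 - W.card * hitProb ω t) ^ S.card := by
  -- Choose the completion of each `R` once and for all; its values at other sets are irrelevant.
  have hex : ∀ R : Finset α, ∃ T : Finset α, Disjoint R W → R.card ≤ t →
      R ⊆ T ∧ Disjoint T W ∧ T.card = t := by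
    intro R
    by_cases h : Disjoint R W ∧ R.card ≤ t
    · have hsub : R ⊆ Wᶜ := by
        rw [Finset.subset_compl_iff_disjoint_right]
        exact h.1
      obtain ⟨T, h1, h2, h3⟩ := Finset.exists_subsuperset_card_eq hsub h.2
        (by rw [Finset.card_compl]; omega)
      exact ⟨T, fun _ _ => ⟨h1, Finset.subset_compl_iff_disjoint_right.1 h2, h3⟩⟩
    · exact ⟨∅, fun h1 h2 => absurd ⟨h1, h2⟩ h⟩
  choose hat hhat using hex
  set Q : ℕ → ℝ := fun s => ∑ I : ι → Finset α, (if Disjoint (peelSet S I s) W then 1 else 0)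
        * ∏ k, missFactor ω S W (hat (peelSet S I s)) k (I k) with hQ
  have hmono : ∀ s ≤ t, Q s ≤ Q 0 := by
    intro s hs
    induction s with
    | zero => exact le_rfl
    | succ s ih => exact (sum_miss_succ_le h0 hω S hhat (by omega)).trans (ih (by omega))
  -- At time `0` the completion is a deterministic set of `t` batches, so the rows factor.
  have hQ0 : Q 0 = (1 - W.card * hitProb ω t) ^ S.card := by
    obtain ⟨-, a2, a3⟩ := hhat ∅ (Finset.disjoint_empty_left W) (by simp)
    simp only [hQ, peelSet, Finset.disjoint_empty_left, if_true, one_mul]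
    have := Finset.prod_univ_sum (fun _ : ι => (Finset.univ : Finset (Finset α)))
      (missFactor ω S W (hat ∅))
    rw [Fintype.piFinset_univ] at this
    rw [← this, Finset.prod_congr rfl fun k _ => sum_missFactor hω S a2 k, a3,
      Finset.prod_ite_mem, Finset.univ_inter, Finset.prod_const]
  rw [← hQ0]
  refine le_trans ?_ (hmono t le_rfl)
  refine Finset.sum_le_sum fun I _ => ?_
  split_ifs with h1 h2 h2
  · obtain ⟨hc, hd, hk⟩ := h1
    -- At time `t` the processed set has `t` elements already and is its own completion.
    have hT : hat (peelSet S I t) = peelSet S I t := by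
      obtain ⟨a1, -, a3⟩ := hhat _ hd hc.le
      exact (Finset.eq_of_subset_of_card_le a1 (by omega)).symm
    rw [hT, mul_one, one_mul]
    refine (Finset.prod_congr rfl fun k _ => ?_).le
    have : ¬ (k ∈ S ∧ Hits W (peelSet S I t) (I k)) := fun h => hk k h.1 h.2
    simp [missFactor, this]
  · exact absurd h1.2.1 h2
  · rw [mul_zero, one_mul]
    exact Finset.prod_nonneg fun k _ => missFactor_nonneg h0 _ _ _ _ _
  · simp

open Classical in
/-- The probability that the peeling process gets stuck with exactly `t` processed batches. -/
theorem sum_stuck_le {ω : ℕ → ℝ} (h0 : ∀ d, 0 ≤ ω d) (hω : ∑ x : Finset α, ω x.card = 1)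
    (S : Finset ι) (t : ℕ) {θ : ℝ} (hθ : 0 ≤ θ) :
    (∑ I : ι → Finset α, (∏ k, ω (I k).card) *
        (if ripple S I (peelSet S I t) = ∅ ∧ (peelSet S I t).card = t then 1 else 0))
        * (1 + θ) ^ (Fintype.card α - t)
      ≤ (1 + θ * Real.exp (-(S.card * hitProb ω t))) ^ Fintype.card α := by
  set A : Finset α → (ι → Finset α) → Prop := fun W I =>
    (peelSet S I t).card = t ∧ Disjoint (peelSet S I t) W ∧
      ∀ k ∈ S, ¬ Hits W (peelSet S I t) (I k) with hA
  have hP : ∀ I : ι → Finset α, 0 ≤ ∏ k, ω (I k).card := fun I =>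
    Finset.prod_nonneg fun k _ => h0 _
  have h1 : ∀ I : ι → Finset α,
      (if ripple S I (peelSet S I t) = ∅ ∧ (peelSet S I t).card = t then (1 : ℝ) else 0)
        * (1 + θ) ^ (Fintype.card α - t)
      ≤ ∑ W : Finset α, θ ^ W.card * (if A W I then 1 else 0) := by
    intro I
    split_ifs with h
    · obtain ⟨hr, hc⟩ := h
      -- All subsets `W` of the complement are avoided, and by the binomial theorem their weights `θ
      -- ^ |W|` add up to `(1 + θ) ^ (m - t)`, where `m` is the number of batches.
      have e1 := Finset.sum_pow_mul_eq_add_pow θ 1 (peelSet S I t)ᶜ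
      simp only [one_pow, mul_one] at e1
      rw [Finset.card_compl, hc, add_comm] at e1
      rw [one_mul, ← e1]
      refine (Finset.sum_le_sum (g := fun W => θ ^ W.card * (if A W I then 1 else 0))
        fun W hW => ?_).trans
        (Finset.sum_le_sum_of_subset_of_nonneg (Finset.subset_univ _) fun W _ _ => ?_)
      · have hd : Disjoint (peelSet S I t) W := by
          rw [disjoint_comm, ← Finset.subset_compl_iff_disjoint_right]
          exact Finset.mem_powerset.1 hW
        have : A W I := by
          refine ⟨hc, hd, fun k hk hh => ?_⟩
          obtain ⟨i, -, hi⟩ := hh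
          have : i ∈ ripple S I (peelSet S I t) := mem_ripple.2 ⟨k, hk, hi⟩
          simp [hr] at this
        simp [this]
      · split_ifs <;> simp [pow_nonneg hθ]
    · rw [zero_mul]
      refine Finset.sum_nonneg fun W _ => ?_
      split_ifs <;> simp [pow_nonneg hθ]
  have h2 : ∀ W : Finset α, ∑ I : ι → Finset α, (∏ k, ω (I k).card) * (if A W I then 1 else 0)
      ≤ Real.exp (-(S.card * hitProb ω t)) ^ W.card := by
    intro W
    by_cases hW : W.card + t ≤ Fintype.card α
    · refine (sum_avoid_le h0 hω S hW).trans ?_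
      obtain ⟨T, hTW, hT⟩ : ∃ T : Finset α, Disjoint T W ∧ T.card = t := by
        obtain ⟨T, h1, h2⟩ := Finset.exists_subset_card_eq (s := Wᶜ) (n := t)
          (by rw [Finset.card_compl]; omega)
        exact ⟨T, Finset.subset_compl_iff_disjoint_right.1 h1, h2⟩
      -- The left side is the probability of hitting `W`; the bound keeps the base nonnegative when
      -- powers are compared.
      have hle : (W.card : ℝ) * hitProb ω t ≤ 1 := by
        rw [← hT, ← sum_hits ω hTW]
        refine le_trans ?_ hω.le
        refine Finset.sum_le_sum fun x _ => ?_
        have := h0 x.card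
        split_ifs <;> simp [this]
      calc (1 - W.card * hitProb ω t) ^ S.card
          ≤ Real.exp (-(W.card * hitProb ω t)) ^ S.card := by
            refine pow_le_pow_left₀ (by linarith) ?_ _
            have := Real.add_one_le_exp (-(W.card * hitProb ω t))
            linarith
        _ = _ := by
            rw [← Real.exp_nat_mul, ← Real.exp_nat_mul]
            congr 1
            ring
    · have : ∀ I, ¬ A W I := by
        rintro I ⟨hc, hd, -⟩
        have := Finset.card_le_univ (peelSet S I t ∪ W)
        rw [Finset.card_union_of_disjoint hd] at this
        omega
      simp only [this, if_false, mul_zero, Finset.sum_const_zero]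
      positivity
  have e3 := Finset.sum_pow_mul_eq_add_pow (θ * Real.exp (-(S.card * hitProb ω t))) 1
    (Finset.univ : Finset α)
  simp only [one_pow, mul_one, Finset.powerset_univ, Finset.card_univ] at e3
  calc _ = ∑ I : ι → Finset α, (∏ k, ω (I k).card) *
        ((if ripple S I (peelSet S I t) = ∅ ∧ (peelSet S I t).card = t then (1 : ℝ) else 0)
        * (1 + θ) ^ (Fintype.card α - t)) := by
        rw [Finset.sum_mul]
        exact Finset.sum_congr rfl fun I _ => mul_assoc _ _ _
    _ ≤ ∑ I : ι → Finset α, (∏ k, ω (I k).card) *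
        ∑ W : Finset α, θ ^ W.card * (if A W I then 1 else 0) :=
        Finset.sum_le_sum fun I _ => mul_le_mul_of_nonneg_left (h1 I) (hP I)
    _ = ∑ W : Finset α, θ ^ W.card * ∑ I : ι → Finset α,
          (∏ k, ω (I k).card) * (if A W I then 1 else 0) := by
        simp only [Finset.mul_sum]
        rw [Finset.sum_comm]
        exact Finset.sum_congr rfl fun W _ => Finset.sum_congr rfl fun I _ => by ring
    _ ≤ ∑ W : Finset α, θ ^ W.card * Real.exp (-(S.card * hitProb ω t)) ^ W.card :=
        Finset.sum_le_sum fun W _ => mul_le_mul_of_nonneg_left (h2 W) (pow_nonneg hθ _)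
    _ = (1 + θ * Real.exp (-(S.card * hitProb ω t))) ^ Fintype.card α := by
        rw [add_comm, ← e3]
        exact Finset.sum_congr rfl fun W _ => (mul_pow _ _ _).symm

end Rows

/-! ### Batches -/

section Batches

variable {n m : ℕ}

theorem mem_batch {i : Fin m} {j : Fin n} : j ∈ batch n m i ↔ (j : ℕ) * m / n = i := by
  simp [batch]

theorem exists_mem_batch (hm : 0 < m) (j : Fin n) : ∃ i, j ∈ batch n m i := by
  have hj := j.isLt
  refine ⟨⟨(j : ℕ) * m / n, ?_⟩, mem_batch.2 rfl⟩
  rw [Nat.div_lt_iff_lt_mul (by omega), Nat.mul_comm]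
  exact Nat.mul_lt_mul_of_pos_left hj hm

theorem eq_of_mem_batch {i i' : Fin m} {j : Fin n} (h : j ∈ batch n m i) (h' : j ∈ batch n m i') :
    i = i' :=
  Fin.ext ((mem_batch.1 h).symm.trans (mem_batch.1 h'))

theorem mem_biUnion_batch {i : Fin m} {j : Fin n} (h : j ∈ batch n m i) (R : Finset (Fin m)) :
    j ∈ R.biUnion (batch n m) ↔ i ∈ R := by
  rw [Finset.mem_biUnion]
  exact ⟨fun ⟨i', hi', hj⟩ => eq_of_mem_batch h hj ▸ hi', fun hi => ⟨i, hi, h⟩⟩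

theorem mem_batch_iff_le_lt {i : Fin m} {j : Fin n} :
    j ∈ batch n m i ↔ (i : ℕ) * n ≤ j * m ∧ (j : ℕ) * m < (i + 1) * n := by
  have hn : 0 < n := j.pos
  rw [mem_batch, Nat.div_eq_iff hn]
  constructor
  · rintro ⟨h1, h2⟩
    refine ⟨by linarith, ?_⟩
    have : (i + 1) * n = i * n + n := by ring
    omega
  · rintro ⟨h1, h2⟩
    refine ⟨by linarith, ?_⟩
    have : (i + 1) * n = i * n + n := by ring
    omega

theorem card_batch_le (i : Fin m) : (batch n m i).card ≤ n / m + 1 := by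
  have hm : 0 < m := i.pos
  rcases (batch n m i).eq_empty_or_nonempty with h | h
  · simp [h]
  set a := (batch n m i).min' h with ha
  have hamem := Finset.min'_mem _ h
  have hsub : (batch n m i).map Fin.valEmbedding ⊆ Finset.Icc (a : ℕ) (a + n / m) := by
    intro j hj
    obtain ⟨j, hj', rfl⟩ := Finset.mem_map.1 hj
    have h1 : a ≤ j := Finset.min'_le _ _ hj'
    have h2 := (mem_batch_iff_le_lt.1 hamem).1
    have h3 := (mem_batch_iff_le_lt.1 hj').2
    rw [← ha] at h2
    simp only [Fin.valEmbedding_apply, Finset.mem_Icc]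
    refine ⟨h1, ?_⟩
    have h4 : (j - a : ℕ) ≤ n / m := by
      rw [Nat.le_div_iff_mul_le hm, Nat.sub_mul]
      have : (i + 1) * n = i * n + n := by ring
      omega
    omega
  have := Finset.card_le_card hsub
  simp only [Finset.card_map, Nat.card_Icc] at this
  generalize n / m = q at *
  omega

theorem le_card_batch (i : Fin m) : n / m ≤ (batch n m i).card := by
  have hm : 0 < m := i.pos
  have hi : (i : ℕ) + 1 ≤ m := i.isLt
  -- This is `⌈i n / m⌉`, the first index that can belong to batch `i`.
  set a := (i * n + (m - 1)) / m with ha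
  have h1 : a * m ≤ i * n + (m - 1) := Nat.div_mul_le_self _ _
  have h2 : i * n ≤ a * m := by
    have := Nat.lt_div_mul_add (a := i * n + (m - 1)) hm
    rw [← ha] at this
    omega
  have h3 : n / m * m ≤ n := Nat.div_mul_le_self _ _
  have h4 : ((i : ℕ) + 1) * n ≤ m * n := Nat.mul_le_mul_right _ hi
  have h5 : ((i : ℕ) + 1) * n = i * n + n := by ring
  have hlt : ∀ l : Fin (n / m), (a + l) * m < (i + 1) * n := by
    intro l
    have : (l + 1 : ℕ) * m ≤ n / m * m := Nat.mul_le_mul_right _ l.isLt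
    have e1 : (l + 1 : ℕ) * m = l * m + m := by ring
    have e2 : (a + l) * m = a * m + l * m := by ring
    omega
  have hlt' : ∀ l : Fin (n / m), a + l < n := by
    intro l
    have := (hlt l).trans_le h4
    rw [Nat.mul_comm m n] at this
    exact Nat.lt_of_mul_lt_mul_right this
  have hcard := Finset.card_le_card_of_injOn (s := (Finset.univ : Finset (Fin (n / m))))
    (t := batch n m i) (fun l => ⟨a + l, hlt' l⟩) (fun l _ => by
      refine mem_batch_iff_le_lt.2 ⟨h2.trans (Nat.mul_le_mul_right _ (by simp)), hlt l⟩)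
    (fun l _ l' _ h => Fin.ext (by simpa using h))
  simpa using hcard

theorem card_biUnion_batch (R : Finset (Fin m)) :
    (R.biUnion (batch n m)).card = ∑ i ∈ R, (batch n m i).card :=
  Finset.card_biUnion fun _ _ _ _ hne =>
    Finset.disjoint_left.2 fun _ hj hj' => hne (eq_of_mem_batch hj hj')

theorem codingMatrix_apply (I : Fin n → Finset (Fin m)) {i : Fin m} {j : Fin n}
    (h : j ∈ batch n m i) (k : Fin n) : codingMatrix I k j = if i ∈ I k then 1 else 0 := by
  simp only [codingMatrix, Matrix.of_apply, mem_biUnion_batch h]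

end Batches

/-! ### Runs of the decoder -/

section Decoder

variable {n m : ℕ} {S : Finset (Fin n)} {I : Fin n → Finset (Fin m)}

/-- What holds in all states of the decoder: the remaining matrix and the results are those of the
rows without the recovered batches, the estimate is the sum over the recovered batches, and all
vectors are in the row space of the received matrix. -/
structure PeelState.Valid (I : Fin n → Finset (Fin m)) (st : PeelState n m S) : Prop where
  M_eq : ∀ k l, st.M k l = if l ∈ I k \ st.recovered then 1 else 0
  res_eq : ∀ k i j, j ∈ batch n m i → st.res k j = if i ∈ I k \ st.recovered then 1 else 0
  grad_eq : ∀ i j, j ∈ batch n m i → st.grad j = if i ∈ st.recovered then 1 else 0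
  res_mem : ∀ k, st.res k ∈ Submodule.span ℝ (Set.range (rowSubmatrix (codingMatrix I) S))
  grad_mem : st.grad ∈ Submodule.span ℝ (Set.range (rowSubmatrix (codingMatrix I) S))

theorem PeelState.valid_init (I : Fin n → Finset (Fin m)) (S : Finset (Fin n)) :
    (PeelState.init I S).Valid I where
  M_eq k l := by simp [PeelState.init]
  res_eq k i j h := by simp [PeelState.init, rowSubmatrix, codingMatrix_apply I h]
  grad_eq i j h := by simp [PeelState.init]
  res_mem k := Submodule.subset_span ⟨k, rfl⟩
  grad_mem := Submodule.zero_mem _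

theorem PeelState.Valid.sdiff_eq {st : PeelState n m S} (h : st.Valid I) {i : S} {k₀ : Fin m}
    (h1 : st.M i k₀ ≠ 0) (h2 : ∀ k, k ≠ k₀ → st.M i k = 0) : I i \ st.recovered = {k₀} := by
  ext l
  rw [Finset.mem_singleton]
  constructor
  · intro hl
    by_contra hne
    have := h2 l hne
    rw [h.M_eq, if_pos hl] at this
    exact one_ne_zero this
  · rintro rfl
    by_contra hl
    rw [h.M_eq, if_neg hl] at h1
    exact h1 rfl

theorem PeelState.Valid.step {st st' : PeelState n m S} (h : st.Valid I) (hs : PeelStep st st') :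
    st'.Valid I := by
  obtain ⟨i, k₀, h1, h2, rfl⟩ := hs
  have hi := h.sdiff_eq h1 h2
  have hk₀ : k₀ ∉ st.recovered := by
    have : k₀ ∈ I i \ st.recovered := by simp [hi]
    exact (Finset.mem_sdiff.1 this).2
  refine ⟨fun k l => ?_, fun k l j hj => ?_, fun l j hj => ?_, fun k => ?_, ?_⟩
  · by_cases hl : l = k₀
    · simp [hl]
    · simp [hl, h.M_eq]
  · simp only [Pi.sub_apply, Pi.smul_apply, smul_eq_mul]
    rw [h.res_eq k l j hj, h.res_eq i l j hj, h.M_eq k k₀, hi]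
    by_cases hl : l = k₀
    · subst hl
      simp
    · simp [hl]
  · simp only [Pi.add_apply]
    rw [h.grad_eq l j hj, h.res_eq i l j hj, hi]
    by_cases hl : l = k₀
    · subst hl
      simp [hk₀]
    · simp [hl]
  · exact Submodule.sub_mem _ (h.res_mem k) (Submodule.smul_mem _ _ (h.res_mem i))
  · exact Submodule.add_mem _ h.grad_mem (h.res_mem i)

theorem PeelState.Valid.reach {st st' : PeelState n m S} (h : st.Valid I)
    (hs : Relation.ReflTransGen PeelStep st st') : st'.Valid I := by
  induction hs with
  | refl => exact h
  | tail _ hbc ih => exact ih.step hbc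

theorem PeelState.Valid.distOne_grad {st : PeelState n m S} (h : st.Valid I) (hm : 0 < m) :
    distOne st.grad = n - ((st.recovered.biUnion (batch n m)).card : ℝ) := by
  have h1 : ∀ j, (st.grad j - 1) ^ 2
      = 1 - if j ∈ st.recovered.biUnion (batch n m) then 1 else 0 := by
    intro j
    obtain ⟨i, hi⟩ := exists_mem_batch hm j
    simp only [h.grad_eq i j hi, mem_biUnion_batch hi]
    split_ifs <;> norm_num
  rw [distOne, Finset.sum_congr rfl fun j _ => h1 j, Finset.sum_sub_distrib, Finset.sum_boole,
    Finset.filter_univ_mem]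
  simp

theorem PeelState.Valid.ripple_eq_empty {st : PeelState n m S} (h : st.Valid I)
    (hs : ¬ ∃ st', PeelStep st st') : ripple S I st.recovered = ∅ := by
  rw [Finset.eq_empty_iff_forall_notMem]
  intro c hc
  obtain ⟨k, hkS, hk⟩ := mem_ripple.1 hc
  refine hs ⟨_, ⟨k, hkS⟩, c, ?_, fun l hl => ?_, rfl⟩
  · rw [h.M_eq]
    simp [hk]
  · rw [h.M_eq]
    simp [hk, hl]

/-- A run with a large error ends with a set of few recovered batches at which no row can be
peeled. -/
theorem PeelErrorExceeds.exists_ripple_eq_empty {ε : ℝ} (hm : 0 < m)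
    (h : PeelErrorExceeds ε (ε * n) I S) :
    ∃ R, ripple S I R = ∅ ∧ ((R.biUnion (batch n m)).card : ℝ) < n * (1 - ε) := by
  obtain ⟨st, hreach, hhalt, herr⟩ := h
  have hv := (PeelState.valid_init I S).reach hreach
  rw [hv.distOne_grad hm] at herr
  rcases hhalt with h1 | h1
  · linarith
  · exact ⟨_, hv.ripple_eq_empty h1, by linarith⟩

theorem PeelState.Valid.exists_halted {st : PeelState n m S} (h : st.Valid I) (ε : ℝ) :
    ∃ st', Relation.ReflTransGen PeelStep st st' ∧ st'.Halted ε := by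
  induction hN : m - st.recovered.card using Nat.strong_induction_on generalizing st with
  | _ N ih =>
    by_cases hs : ∃ st', PeelStep st st'
    · obtain ⟨st', hs⟩ := hs
      have hlt : m - st'.recovered.card < N := by
        obtain ⟨i, k₀, h1, h2, rfl⟩ := hs
        have hk₀ : k₀ ∈ I i \ st.recovered := by simp [h.sdiff_eq h1 h2]
        have hcard := Finset.card_insert_of_notMem (Finset.mem_sdiff.1 hk₀).2
        have hle := Finset.card_le_univ (insert k₀ st.recovered)
        rw [Fintype.card_fin] at hle
        simp only
        omega
      obtain ⟨st'', h1, h2⟩ := ih _ hlt (h.step hs) rfl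
      exact ⟨st'', Relation.ReflTransGen.head hs h1, h2⟩
    · exact ⟨st, Relation.ReflTransGen.refl, Or.inr hs⟩

theorem err_le_of_mem_span {A : Matrix (Fin n) (Fin n) ℝ} {v : Fin n → ℝ}
    (hv : v ∈ Submodule.span ℝ (Set.range (rowSubmatrix A S))) : err A S ≤ distOne v := by
  obtain ⟨c, hc⟩ := (Submodule.mem_span_range_iff_exists_fun ℝ).1 hv
  have : (rowSubmatrix A S).transpose.mulVec c = v := by
    rw [Matrix.mulVec_transpose, Matrix.vecMul_eq_sum, ← hc]
  rw [← this]
  refine ciInf_le ⟨0, ?_⟩ c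
  rintro _ ⟨u, rfl⟩
  exact Finset.sum_nonneg fun j _ => sq_nonneg _

/-- Some run halts, and its estimate is a combination of received rows, so its error is at least the
optimal one. -/
theorem peelErrorExceeds_of_lt_err {ε c : ℝ} (h : c < err (codingMatrix I) S) :
    PeelErrorExceeds ε c I S := by
  obtain ⟨st, h1, h2⟩ := (PeelState.valid_init I S).exists_halted ε
  exact ⟨st, h1, h2, h.trans_le (err_le_of_mem_span ((PeelState.valid_init I S).reach h1).grad_mem)⟩

/-- If the decoder can stop with a large error, the peeling process gets stuck early. -/
theorem PeelErrorExceeds.exists_stuck {ε : ℝ} {b : ℕ} (hm : 0 < m) (hb : b * m ≤ n)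
    (h : PeelErrorExceeds ε (ε * n) I S) :
    ∃ t, ripple S I (peelSet S I t) = ∅ ∧ (peelSet S I t).card = t ∧
      (b * t : ℝ) < n * (1 - ε) := by
  obtain ⟨R, hR, hcard⟩ := h.exists_ripple_eq_empty hm
  obtain ⟨t, h1, h2⟩ := BatchRaptor.exists_ripple_eq_empty S I
  refine ⟨t, h1, h2, lt_of_le_of_lt ?_ hcard⟩
  have h3 : t ≤ R.card := by
    rw [← h2]
    exact Finset.card_le_card (peelSet_subset hR t)
  have h4 : b * t ≤ (R.biUnion (batch n m)).card := by
    rw [card_biUnion_batch]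
    calc b * t ≤ R.card * b := by rw [Nat.mul_comm]; exact Nat.mul_le_mul_right _ h3
      _ = ∑ _i ∈ R, b := by simp
      _ ≤ _ := Finset.sum_le_sum fun i _ =>
        ((Nat.le_div_iff_mul_le hm).2 hb).trans (le_card_batch i)
  exact_mod_cast h4

/-- The decoder recovers everything if each batch is received alone. -/
theorem not_peelErrorExceeds {ε : ℝ} (hε : 0 ≤ ε) (hm : 0 < m)
    (h : ∀ i, ∃ k ∈ S, I k = {i}) : ¬ PeelErrorExceeds ε (ε * n) I S := by
  intro hexc
  obtain ⟨R, hR, hcard⟩ := hexc.exists_ripple_eq_empty hm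
  have hall : ∀ i, i ∈ R := by
    intro i
    by_contra hi
    obtain ⟨k, hkS, hk⟩ := h i
    have : i ∈ ripple S I R := mem_ripple.2 ⟨k, hkS, by rw [hk]; simp [hi]⟩
    simp [hR] at this
  have huniv : R.biUnion (batch n m) = Finset.univ := by
    rw [Finset.eq_univ_iff_forall]
    intro j
    obtain ⟨i, hi⟩ := exists_mem_batch hm j
    exact (mem_biUnion_batch hi R).2 (hall i)
  rw [huniv, Finset.card_univ, Fintype.card_fin] at hcard
  have : (0 : ℝ) ≤ n * ε := by positivity
  linarith

end Decoder

/-! ### The law of the code -/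

section Law

/-- The probability of a set with `d` elements under the law of the batches of one worker. -/
def setWeight (ε : ℝ) (m d : ℕ) : ℝ := solitonWeight ε d / m.choose d

theorem solitonWeight_zero (ε : ℝ) : solitonWeight ε 0 = 0 := by
  simp [solitonWeight]

theorem setWeight_nonneg {ε : ℝ} (h0 : 0 < ε) (h4 : ε < 1 / 4) (m d : ℕ) :
    0 ≤ setWeight ε m d :=
  div_nonneg (solitonWeight_nonneg h0 h4 d) (Nat.cast_nonneg _)

variable {n m : ℕ} {ε : ℝ}

theorem workerPMF_toReal (h0 : 0 < ε) (h4 : ε < 1 / 4) (hm : maxDeg ε + 1 ≤ m)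
    (x : Finset (Fin m)) :
    (workerPMF (solitonPMF m ε h0 h4 hm) x).toReal = setWeight ε m x.card := by
  have hterm : ∀ d : Fin m, (solitonPMF m ε h0 h4 hm d * uniformSubset m ((d : ℕ) + 1) d.isLt x)
      = if (d : ℕ) + 1 = x.card then ENNReal.ofReal (setWeight ε m x.card) else 0 := by
    intro d
    rw [uniformSubset, PMF.uniformOfFinset_apply]
    simp only [Finset.mem_powersetCard, Finset.subset_univ, true_and, Finset.card_powersetCard,
      Finset.card_univ, Fintype.card_fin]
    split_ifs with h1 h2 h2
    · have hpos : (0 : ℝ) < m.choose x.card := by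
        have : x.card ≤ m := by simpa using Finset.card_le_univ x
        exact_mod_cast Nat.choose_pos this
      rw [solitonPMF, PMF.ofFintype_apply, setWeight, h2, ENNReal.ofReal_div_of_pos hpos,
        ENNReal.ofReal_natCast, div_eq_mul_inv]
    · exact absurd h1.symm h2
    · exact absurd h2.symm h1
    · rw [mul_zero]
  rw [workerPMF, PMF.bind_apply, tsum_fintype, Finset.sum_congr rfl fun d _ => hterm d]
  rcases Nat.eq_zero_or_pos x.card with hx | hx
  · rw [Finset.sum_eq_zero fun d _ => if_neg (by omega), hx]
    simp [setWeight, solitonWeight_zero]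
  · have hxm : x.card ≤ m := by simpa using Finset.card_le_univ x
    rw [Finset.sum_eq_single (⟨x.card - 1, by omega⟩ : Fin m)]
    · rw [if_pos (by simp only; omega), ENNReal.toReal_ofReal (setWeight_nonneg h0 h4 _ _)]
    · intro d _ hd
      refine if_neg fun h => hd (Fin.ext ?_)
      simp only
      omega
    · simp

theorem sum_setWeight (h0 : 0 < ε) (h4 : ε < 1 / 4) (hm : maxDeg ε + 1 ≤ m) :
    ∑ x : Finset (Fin m), setWeight ε m x.card = 1 := by
  have h := (workerPMF (solitonPMF m ε h0 h4 hm)).tsum_coe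
  rw [tsum_fintype] at h
  rw [← ENNReal.toReal_one, ← h, ENNReal.toReal_sum fun x _ => PMF.apply_ne_top _ _]
  exact Finset.sum_congr rfl fun x _ => (workerPMF_toReal h0 h4 hm x).symm

instance (P : PMF (Fin m)) : IsProbabilityMeasure (codeLaw n P) := by
  unfold codeLaw
  infer_instance

instance (s : ℕ) (P : PMF (Fin m)) : IsProbabilityMeasure (codeStragglerLaw n s P) := by
  unfold codeStragglerLaw
  infer_instance

theorem codeLaw_real_singleton (h0 : 0 < ε) (h4 : ε < 1 / 4) (hm : maxDeg ε + 1 ≤ m)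
    (I : Fin n → Finset (Fin m)) :
    (codeLaw n (solitonPMF m ε h0 h4 hm)).real {I} = ∏ k, setWeight ε m (I k).card := by
  rw [measureReal_def, codeLaw, Measure.pi_singleton, ENNReal.toReal_prod]
  refine Finset.prod_congr rfl fun k _ => ?_
  rw [PMF.toMeasure_apply_singleton _ _ (measurableSet_singleton _), workerPMF_toReal h0 h4 hm]

open Classical in
theorem codeLaw_real (h0 : 0 < ε) (h4 : ε < 1 / 4) (hm : maxDeg ε + 1 ≤ m)
    (p : (Fin n → Finset (Fin m)) → Prop) :
    (codeLaw n (solitonPMF m ε h0 h4 hm)).real {I | p I}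
      = ∑ I : Fin n → Finset (Fin m), (∏ k, setWeight ε m (I k).card) * if p I then 1 else 0 := by
  have h : {I | p I} = ((Finset.univ.filter p : Finset (Fin n → Finset (Fin m))) : Set _) := by
    ext I
    simp
  rw [h, ← sum_measureReal_singleton, Finset.sum_filter]
  refine Finset.sum_congr rfl fun I _ => ?_
  rw [codeLaw_real_singleton]
  simp

/-- By independence the code can be integrated out first, for each fixed set of received rows. -/
theorem codeStragglerLaw_real_le {s : ℕ} (P : PMF (Fin m))
    (p : (Fin n → Finset (Fin m)) → Finset (Fin n) → Prop) {c : ℝ} (hc : 0 ≤ c)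
    (h : ∀ S : Finset (Fin n), S.card = n - s → (codeLaw n P).real {I | p I S} ≤ c) :
    (codeStragglerLaw n s P).real {ω | p ω.1 ω.2} ≤ c := by
  have hae : ∀ᵐ S ∂(uniformSubset n (n - s) (Nat.sub_le n s)).toMeasure, S.card = n - s := by
    rw [ae_iff, PMF.toMeasure_apply_eq_zero_iff _ (Set.toFinite _).measurableSet,
      uniformSubset, PMF.support_uniformOfFinset, Set.disjoint_left]
    intro S hS hS'
    exact hS' (Finset.mem_powersetCard.1 hS).2
  refine ENNReal.toReal_le_of_le_ofReal hc ?_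
  rw [codeStragglerLaw, Measure.prod_apply_symm (Set.toFinite _).measurableSet]
  refine (lintegral_mono_ae (g := fun _ => ENNReal.ofReal c) ?_).trans (by simp)
  filter_upwards [hae] with S hS
  have := h S hS
  rw [measureReal_def] at this
  exact (ENNReal.le_ofReal_iff_toReal_le (measure_ne_top _ _) hc).2 this

theorem codeLaw_real_stuck_le (h0 : 0 < ε) (h4 : ε < 1 / 4) (hm : maxDeg ε + 1 ≤ m)
    (S : Finset (Fin n)) (t : ℕ) {θ : ℝ} (hθ : 0 ≤ θ) :
    (codeLaw n (solitonPMF m ε h0 h4 hm)).real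
        {I | ripple S I (peelSet S I t) = ∅ ∧ (peelSet S I t).card = t} * (1 + θ) ^ (m - t)
      ≤ (1 + θ * Real.exp (-(S.card * hitProb (setWeight ε m) t))) ^ m := by
  classical
  have := sum_stuck_le (ι := Fin n) (α := Fin m) (setWeight_nonneg h0 h4 m)
    (sum_setWeight h0 h4 hm) S t hθ
  rw [Fintype.card_fin] at this
  rw [codeLaw_real]
  convert this

theorem codeLaw_real_exceeds_le {b : ℕ} (h0 : 0 < ε) (h4 : ε < 1 / 4) (hm : maxDeg ε + 1 ≤ m)
    (hb : b * m ≤ n) (S : Finset (Fin n)) {c : ℝ} (hc : 0 ≤ c)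
    (h : ∀ t ≤ m, (b * t : ℝ) < n * (1 - ε) → (codeLaw n (solitonPMF m ε h0 h4 hm)).real
        {I | ripple S I (peelSet S I t) = ∅ ∧ (peelSet S I t).card = t} ≤ c) :
    (codeLaw n (solitonPMF m ε h0 h4 hm)).real {I | PeelErrorExceeds ε (ε * n) I S}
      ≤ (m + 1) * c := by
  have hm0 : 0 < m := by omega
  set A : ℕ → Set (Fin n → Finset (Fin m)) := fun t =>
    {I | (b * t : ℝ) < n * (1 - ε) ∧ ripple S I (peelSet S I t) = ∅ ∧ (peelSet S I t).card = t}
    with hA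
  have hsub : {I | PeelErrorExceeds ε (ε * n) I S} ⊆ ⋃ t ∈ Finset.range (m + 1), A t := by
    intro I hI
    obtain ⟨t, h1, h2, h3⟩ := PeelErrorExceeds.exists_stuck hm0 hb hI
    have htm : t ≤ m := by
      rw [← h2]
      simpa using Finset.card_le_univ (peelSet S I t)
    simp only [Set.mem_iUnion]
    exact ⟨t, Finset.mem_range.2 (by omega), h3, h1, h2⟩
  have hle : ∀ t ∈ Finset.range (m + 1),
      (codeLaw n (solitonPMF m ε h0 h4 hm)).real (A t) ≤ c := by
    intro t ht
    by_cases hbt : (b * t : ℝ) < n * (1 - ε)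
    · exact (measureReal_mono fun I hI => hI.2).trans
        (h t (by simpa [Nat.lt_succ_iff] using ht) hbt)
    · have : A t = ∅ := Set.eq_empty_of_forall_notMem fun I hI => hbt hI.1
      simpa [this] using hc
  calc _ ≤ (codeLaw n (solitonPMF m ε h0 h4 hm)).real (⋃ t ∈ Finset.range (m + 1), A t) :=
        measureReal_mono hsub (measure_ne_top _ _)
    _ ≤ ∑ t ∈ Finset.range (m + 1), (codeLaw n (solitonPMF m ε h0 h4 hm)).real (A t) :=
        measureReal_biUnion_finset_le _ _
    _ ≤ ∑ _t ∈ Finset.range (m + 1), c := Finset.sum_le_sum hle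
    _ = (m + 1) * c := by simp

theorem codeLaw_real_exceeds_le_one_sub (h0 : 0 < ε) (h4 : ε < 1 / 4) (hm : maxDeg ε + 1 ≤ m)
    (S : Finset (Fin n)) (hS : m ≤ S.card) :
    (codeLaw n (solitonPMF m ε h0 h4 hm)).real {I | PeelErrorExceeds ε (ε * n) I S}
      ≤ 1 - setWeight ε m 1 ^ n := by
  have hm0 : 0 < m := by omega
  obtain ⟨g⟩ : Nonempty (Fin m ↪ S) := Function.Embedding.nonempty_of_card_le (by simpa using hS)
  have hg : Function.Injective fun i => (g i : Fin n) :=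
    Subtype.val_injective.comp g.injective
  have : Nonempty (Fin m) := ⟨⟨0, hm0⟩⟩
  -- One good code: all rows have degree one, and the rows in the image of `g` cover every batch.
  -- Its probability is already the required gain.
  set I₀ : Fin n → Finset (Fin m) := fun k => {Function.invFun (fun i => (g i : Fin n)) k}
    with hI₀
  have hgood : ¬ PeelErrorExceeds ε (ε * n) I₀ S :=
    not_peelErrorExceeds h0.le hm0 fun i =>
      ⟨g i, (g i).2, by simp only [hI₀]; rw [Function.leftInverse_invFun hg i]⟩
  have h1 := codeLaw_real_singleton h0 h4 hm I₀
  simp only [hI₀, Finset.card_singleton, Finset.prod_const, Finset.card_univ,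
    Fintype.card_fin] at h1
  rw [← h1, ← probReal_compl_eq_one_sub (measurableSet_singleton _)]
  exact measureReal_mono fun I hI => by
    rintro rfl
    exact hgood hI

end Law

/-! ### Density evolution -/

section DensityEvolution

/-- The ratio is the product of `(t - i) / (M - i)` over `i < j`. Each factor loses at most `i / (M
+ 1)` against `t / (M + 1)`, and these losses add up to less than the error term; for `t < j` the
left side is nonpositive by size. -/
theorem sub_le_choose_div_choose {M t : ℕ} (ht : t ≤ M) {j : ℕ} (hj : j ≤ M) :
    ((t : ℝ) / (M + 1)) ^ j - (j : ℝ) ^ 2 / (M + 1) ≤ (t.choose j : ℝ) / M.choose j := by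
  have hM : (0 : ℝ) < M + 1 := by positivity
  induction j with
  | zero => simp
  | succ j ih =>
    have ih := ih (by omega)
    set y : ℝ := (t : ℝ) / (M + 1) with hy
    have hy0 : 0 ≤ y := by positivity
    have hy1 : y ≤ 1 := by
      rw [hy, div_le_one hM]
      exact_mod_cast ht.trans (Nat.le_succ M)
    set a : ℝ := (t.choose j : ℝ) / M.choose j with ha
    have ha0 : 0 ≤ a := by positivity
    have hcM : (0 : ℝ) < M.choose j := by exact_mod_cast Nat.choose_pos (by omega)
    have hcM' : (0 : ℝ) < M.choose (j + 1) := by exact_mod_cast Nat.choose_pos hj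
    have ha1 : a ≤ 1 := by
      rw [ha, div_le_one hcM]
      exact_mod_cast Nat.choose_le_choose j ht
    rcases Nat.lt_or_ge t j with hlt | hge
    · have h1 : y ≤ (j : ℝ) / (M + 1) := by
        rw [hy]
        gcongr
      have h2 : y ^ (j + 1) ≤ y := pow_le_of_le_one hy0 hy1 (by omega)
      have h3 : (j : ℝ) / (M + 1) ≤ ((j + 1 : ℕ) : ℝ) ^ 2 / (M + 1) := by
        gcongr
        push_cast
        nlinarith [Nat.cast_nonneg (α := ℝ) j]
      have h4 : (0 : ℝ) ≤ (t.choose (j + 1) : ℝ) / M.choose (j + 1) := by positivity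
      linarith
    · have hMj : (0 : ℝ) < (M : ℝ) - j := by
        have : ((j + 1 : ℕ) : ℝ) ≤ M := by exact_mod_cast hj
        push_cast at this
        linarith
      have htj : (0 : ℝ) ≤ (t : ℝ) - j := by
        have : (j : ℝ) ≤ t := by exact_mod_cast hge
        linarith
      have e1 : (t.choose (j + 1) : ℝ) * (j + 1) = t.choose j * (t - j) := by
        rw [← Nat.cast_sub hge]
        exact_mod_cast Nat.choose_succ_right_eq t j
      have e2 : (M.choose (j + 1) : ℝ) * (j + 1) = M.choose j * (M - j) := by
        rw [← Nat.cast_sub (by omega : j ≤ M)]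
        exact_mod_cast Nat.choose_succ_right_eq M j
      have e3 : (t.choose (j + 1) : ℝ) / M.choose (j + 1) = a * ((t - j) / (M - j)) := by
        have hj1 : (0 : ℝ) < j + 1 := by positivity
        rw [ha, div_mul_div_comm, ← e1, ← e2, mul_div_mul_right _ _ hj1.ne']
      have h5 : ((t : ℝ) - j) / (M + 1) ≤ (t - j) / (M - j) := by
        apply div_le_div_of_nonneg_left htj hMj
        linarith [Nat.cast_nonneg (α := ℝ) j]
      have h6 : ((t : ℝ) - j) / (M + 1) = y - j / (M + 1) := by rw [hy, sub_div]
      have hjM : (0 : ℝ) ≤ (j : ℝ) / (M + 1) := by positivity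
      have hj2M : (0 : ℝ) ≤ (j : ℝ) ^ 2 / (M + 1) := by positivity
      have h7 : a * (y - j / (M + 1)) ≤ a * ((t - j) / (M - j)) := by
        rw [← h6]
        exact mul_le_mul_of_nonneg_left h5 ha0
      have h8 : (y ^ j - (j : ℝ) ^ 2 / (M + 1)) * y ≤ a * y := mul_le_mul_of_nonneg_right ih hy0
      have h9 : (j : ℝ) ^ 2 / (M + 1) * y ≤ (j : ℝ) ^ 2 / (M + 1) :=
        mul_le_of_le_one_right hj2M hy1
      have h10 : a * (j / (M + 1)) ≤ (j : ℝ) / (M + 1) := mul_le_of_le_one_left hjM ha1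
      have h11 : ((j + 1 : ℕ) : ℝ) ^ 2 / (M + 1)
          = (j : ℝ) ^ 2 / (M + 1) + j / (M + 1) + (j + 1) / (M + 1) := by
        push_cast
        ring
      have h12 : (0 : ℝ) ≤ ((j : ℝ) + 1) / (M + 1) := by positivity
      rw [e3, h11, pow_succ]
      nlinarith

/-- The derivative `∑ d p_d y^(d-1)` of the generating function of the degree distribution. -/
def degreeDeriv (ε y : ℝ) : ℝ :=
  ∑ j ∈ Finset.range (maxDeg ε + 1), ((j : ℝ) + 1) * solitonWeight ε (j + 1) * y ^ j

/-- The constant in the comparison of the finite code with its limit. -/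
def degreeDefect (ε : ℝ) : ℝ :=
  ∑ j ∈ Finset.range (maxDeg ε + 1), ((j : ℝ) + 1) * solitonWeight ε (j + 1) * (j : ℝ) ^ 2

theorem degreeDefect_nonneg {ε : ℝ} (h0 : 0 < ε) (h4 : ε < 1 / 4) : 0 ≤ degreeDefect ε :=
  Finset.sum_nonneg fun j _ =>
    mul_nonneg (mul_nonneg (by positivity) (solitonWeight_nonneg h0 h4 _)) (by positivity)

theorem degreeDeriv_mono {ε : ℝ} (h0 : 0 < ε) (h4 : ε < 1 / 4) {y z : ℝ} (hy : 0 ≤ y)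
    (hyz : y ≤ z) : degreeDeriv ε y ≤ degreeDeriv ε z :=
  Finset.sum_le_sum fun j _ => mul_le_mul_of_nonneg_left (pow_le_pow_left₀ hy hyz j)
    (mul_nonneg (by positivity) (solitonWeight_nonneg h0 h4 _))

theorem solitonWeight_eq_zero {ε : ℝ} (h0 : 0 < ε) (h4 : ε < 1 / 4) {k : ℕ}
    (hk : maxDeg ε + 1 < k) : solitonWeight ε k = 0 := by
  have := four_le_maxDeg h0 h4
  unfold solitonWeight
  rw [if_neg (by omega), if_neg (by omega), if_neg (by omega)]

/-- Since `m / m.choose (j + 1) = (j + 1) / (m - 1).choose j`, the right side is the derivative with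
`y ^ j` replaced by a ratio of binomial coefficients. -/
theorem degreeDeriv_sub_le_mul_hitProb {ε : ℝ} (h0 : 0 < ε) (h4 : ε < 1 / 4) {m t : ℕ}
    (hm : maxDeg ε + 1 ≤ m) (ht : t < m) :
    degreeDeriv ε (t / m) - degreeDefect ε / m ≤ m * hitProb (setWeight ε m) t := by
  obtain ⟨M, rfl⟩ : ∃ M, m = M + 1 := ⟨m - 1, by omega⟩
  have hsum : hitProb (setWeight ε (M + 1)) t
      = ∑ j ∈ Finset.range (maxDeg ε + 1),
        (t.choose j : ℝ) * setWeight ε (M + 1) (j + 1) := by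
    have hA : ∑ j ∈ Finset.range (maxDeg ε + 1 + (t + 1)),
        (t.choose j : ℝ) * setWeight ε (M + 1) (j + 1) = hitProb (setWeight ε (M + 1)) t := by
      refine (Finset.sum_subset (Finset.range_subset_range.2 (by omega)) fun j _ hj => ?_).symm
      rw [Finset.mem_range] at hj
      rw [Nat.choose_eq_zero_of_lt (by omega)]
      simp
    rw [← hA]
    refine (Finset.sum_subset (Finset.range_subset_range.2 (by omega)) fun j _ hj => ?_).symm
    rw [Finset.mem_range] at hj
    rw [setWeight, solitonWeight_eq_zero h0 h4 (by omega)]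
    simp
  rw [hsum, degreeDeriv, degreeDefect, Finset.sum_div, ← Finset.sum_sub_distrib, Finset.mul_sum]
  refine Finset.sum_le_sum fun j hj => ?_
  rw [Finset.mem_range] at hj
  have hjM : j ≤ M := by omega
  have hw : 0 ≤ ((j : ℝ) + 1) * solitonWeight ε (j + 1) :=
    mul_nonneg (by positivity) (solitonWeight_nonneg h0 h4 _)
  have h1 := mul_le_mul_of_nonneg_left
    (sub_le_choose_div_choose (Nat.lt_succ_iff.1 ht) hjM) hw
  have hc : (0 : ℝ) < M.choose j := by exact_mod_cast Nat.choose_pos hjM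
  have hc' : (0 : ℝ) < (M + 1).choose (j + 1) := by
    exact_mod_cast Nat.choose_pos (by omega)
  have e : ((M : ℝ) + 1) * M.choose j = (M + 1).choose (j + 1) * (j + 1) := by
    exact_mod_cast Nat.add_one_mul_choose_eq M j
  have h2 : ((M + 1 : ℕ) : ℝ) * ((t.choose j : ℝ) * setWeight ε (M + 1) (j + 1))
      = ((j : ℝ) + 1) * solitonWeight ε (j + 1) * ((t.choose j : ℝ) / M.choose j) := by
    rw [setWeight]
    push_cast
    field_simp
    linear_combination (t.choose j : ℝ) * solitonWeight ε (j + 1) * e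
  rw [h2]
  refine le_trans (le_of_eq ?_) h1
  push_cast
  ring

theorem neg_log_one_sub_le {y : ℝ} (h0 : 0 ≤ y) (h1 : y < 1) (D : ℕ) :
    -Real.log (1 - y) ≤ ∑ i ∈ Finset.range D, y ^ (i + 1) / ((i : ℝ) + 1)
      + y ^ (D + 1) / ((D + 1) * (1 - y)) := by
  have hs := Real.hasSum_pow_div_log_of_abs_lt_one (x := y) (by rwa [abs_of_nonneg h0])
  have h2 := (hasSum_nat_add_iff' D).2 hs
  have h3 := (hasSum_geometric_of_lt_one h0 h1).mul_left (y ^ (D + 1) / ((D : ℝ) + 1))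
  have h4 := hasSum_le (fun k => ?_) h2 h3
  · have : y ^ (D + 1) / ((D : ℝ) + 1) * (1 - y)⁻¹ = y ^ (D + 1) / ((D + 1) * (1 - y)) := by
      rw [← div_eq_mul_inv, div_div]
    linarith
  · have e : y ^ (k + D + 1) = y ^ (D + 1) * y ^ k := by ring
    rw [e, div_mul_eq_mul_div]
    push_cast
    gcongr
    linarith [Nat.cast_nonneg (α := ℝ) k]

/-- The top degree contributes `(1 + 1 / D) y ^ D`, with `D = maxDeg ε`: the part `y ^ D / D`
completes the truncated logarithm series, and `y ^ D` is left to pay for its tail. -/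
theorem mul_degreeDeriv {ε : ℝ} (h0 : 0 < ε) (h4 : ε < 1 / 4) (y : ℝ) :
    (solitonU ε + 1) * degreeDeriv ε y = solitonU ε
      + ∑ i ∈ Finset.range (maxDeg ε), y ^ (i + 1) / ((i : ℝ) + 1) + y ^ maxDeg ε := by
  have hu := solitonU_nonneg h0 h4
  have hD := four_le_maxDeg h0 h4
  have hu1 : solitonU ε + 1 ≠ 0 := by positivity
  obtain ⟨E, hE⟩ : ∃ E, maxDeg ε = E + 1 := ⟨maxDeg ε - 1, by omega⟩
  have h1 : ∀ i ∈ Finset.range E, (((i + 1 : ℕ) : ℝ) + 1) * solitonWeight ε (i + 1 + 1)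
      * y ^ (i + 1) = (solitonU ε + 1)⁻¹ * (y ^ (i + 1) / ((i : ℝ) + 1)) := by
    intro i hi
    rw [Finset.mem_range] at hi
    unfold solitonWeight
    rw [if_neg (by omega), if_neg (by omega), if_pos (by omega)]
    push_cast
    have : (i : ℝ) + 1 ≠ 0 := by positivity
    have : (i : ℝ) + 1 + 1 ≠ 0 := by positivity
    have : (i : ℝ) + 1 + 1 - 1 ≠ 0 := by
      rw [add_sub_cancel_right]
      positivity
    field_simp
    ring
  have h2 : solitonWeight ε (0 + 1) = solitonU ε / (solitonU ε + 1) := by simp [solitonWeight]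
  have h3 : solitonWeight ε (E + 1 + 1) = 1 / (((E + 1 : ℕ) : ℝ) * (solitonU ε + 1)) := by
    unfold solitonWeight
    rw [if_neg (by omega), if_pos (by omega), hE]
  rw [degreeDeriv, hE, Finset.sum_range_succ, Finset.sum_range_succ', Finset.sum_congr rfl h1,
    ← Finset.mul_sum, h2, h3, Finset.sum_range_succ (fun i : ℕ => y ^ (i + 1) / ((i : ℝ) + 1))]
  have : (E : ℝ) + 1 ≠ 0 := by positivity
  push_cast
  field_simp
  ring

theorem solitonU_sub_log_le {ε : ℝ} (h0 : 0 < ε) (h4 : ε < 1 / 4) {y : ℝ} (hy : 0 ≤ y)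
    (hy1 : y ≤ 1 - ε) :
    solitonU ε - Real.log (1 - y) ≤ (solitonU ε + 1) * degreeDeriv ε y := by
  have hu := solitonU_nonneg h0 h4
  have hD := four_le_maxDeg h0 h4
  have hDε : 1 < ((maxDeg ε : ℝ) + 1) * ε := by
    have : 1 / ε < (maxDeg ε : ℝ) + 1 := Nat.lt_floor_add_one _
    rwa [div_lt_iff₀ h0] at this
  have hexp := mul_degreeDeriv h0 h4 y
  have hlog := neg_log_one_sub_le hy (by linarith) (maxDeg ε)
  -- Here the cutoff enters: `1 - y ≥ ε` and `(D + 1) ε > 1`.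
  have htail : y ^ (maxDeg ε + 1) / (((maxDeg ε : ℝ) + 1) * (1 - y)) ≤ y ^ maxDeg ε := by
    have h1 : (0 : ℝ) < (maxDeg ε : ℝ) + 1 := by positivity
    have h2 : ((maxDeg ε : ℝ) + 1) * ε ≤ ((maxDeg ε : ℝ) + 1) * (1 - y) :=
      mul_le_mul_of_nonneg_left (by linarith) h1.le
    rw [div_le_iff₀ (by nlinarith), pow_succ]
    exact mul_le_mul_of_nonneg_left (by linarith) (pow_nonneg hy _)
  rw [hexp]
  linarith

/-- The number of received rows per batch that suffices for decoding. -/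
def overhead (ε : ℝ) : ℝ := (1 - 2 * ε) / (1 - 4 * ε)

theorem one_lt_overhead {ε : ℝ} (h0 : 0 < ε) (h4 : ε < 1 / 4) : 1 < overhead ε := by
  rw [overhead, one_lt_div (by linarith)]
  linarith

theorem overhead_sub_one {ε : ℝ} (h4 : ε < 1 / 4) : overhead ε - 1 = 2 * ε / (1 - 4 * ε) := by
  have : 1 - 4 * ε ≠ 0 := by linarith
  rw [overhead, div_sub_one this]
  ring_nf

theorem solitonU_eq {ε : ℝ} (h4 : ε < 1 / 4) :
    solitonU ε = overhead ε * (overhead ε - 1) := by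
  rw [overhead_sub_one h4, overhead, div_mul_div_comm, solitonU]
  ring_nf

/-- From `log (1 / ε) < 1 / (2 ε)` the left side is below `1 / (1 - 4 ε)`, and `1 - 4 ε ≤ (1 - 2 ε)
^ 2`. This makes the margin positive. -/
theorem overhead_sub_one_mul_log_lt {ε : ℝ} (h0 : 0 < ε) (h4 : ε < 1 / 4) :
    (overhead ε - 1) * Real.log (1 / ε) < overhead ε ^ 2 := by
  have h5 : 0 < 1 - 4 * ε := by linarith
  have hlog : Real.log (1 / ε) < 1 / (2 * ε) := by
    have h1 := Real.log_le_sub_one_of_pos (show 0 < 1 / (2 * ε) by positivity)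
    have h2 : Real.log (1 / ε) = Real.log 2 + Real.log (1 / (2 * ε)) := by
      rw [← Real.log_mul (by norm_num) (by positivity)]
      congr 1
      field_simp
    have h3 := Real.log_two_lt_d9
    linarith
  have e := overhead_sub_one h4
  have hpos : 0 < overhead ε - 1 := by linarith [one_lt_overhead h0 h4]
  calc (overhead ε - 1) * Real.log (1 / ε) < (overhead ε - 1) * (1 / (2 * ε)) :=
        mul_lt_mul_of_pos_left hlog hpos
    _ = 1 / (1 - 4 * ε) := by
        rw [e]
        field_simp
    _ ≤ overhead ε ^ 2 := by
        rw [overhead, div_pow, div_le_div_iff₀ h5 (by positivity)]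
        nlinarith [mul_pos h0 h0]

/-- The density evolution inequality holds with a margin up to the fraction `1 - ε`. -/
theorem exists_margin {ε : ℝ} (h0 : 0 < ε) (h4 : ε < 1 / 4) :
    ∃ γ : ℝ, 0 < γ ∧ ∀ y : ℝ, 0 ≤ y → y ≤ 1 - ε →
      γ - Real.log (1 - y) ≤ overhead ε * degreeDeriv ε y := by
  set r := overhead ε with hr
  have hr1 : 1 < r := one_lt_overhead h0 h4
  have hu : solitonU ε = r * (r - 1) := solitonU_eq h4
  have hupos : 0 < solitonU ε + 1 := by linarith [solitonU_nonneg h0 h4]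
  have hmain := overhead_sub_one_mul_log_lt h0 h4
  -- With `u = r (r - 1)` and `L = -log (1 - y)`, `r (u + L) / (u + 1) - L` equals this expression
  -- with `L` in place of `log (1 / ε)`. It decreases in `L`, and `L ≤ log (1 / ε)`.
  refine ⟨(r - 1) * (r ^ 2 - (r - 1) * Real.log (1 / ε)) / (solitonU ε + 1), ?_, ?_⟩
  · exact div_pos (mul_pos (by linarith) (by linarith)) hupos
  · intro y hy hy1
    have h1 := solitonU_sub_log_le h0 h4 hy hy1
    have h2 : -Real.log (1 - y) ≤ Real.log (1 / ε) := by
      rw [one_div, Real.log_inv]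
      exact neg_le_neg (Real.log_le_log h0 (by linarith))
    rw [← sub_nonneg] at h1 ⊢
    have h3 : (r * degreeDeriv ε y - ((r - 1) * (r ^ 2 - (r - 1) * Real.log (1 / ε))
        / (solitonU ε + 1) - Real.log (1 - y))) * (solitonU ε + 1)
        = r * ((solitonU ε + 1) * degreeDeriv ε y - (solitonU ε - Real.log (1 - y)))
          + (r - 1) ^ 2 * (Real.log (1 / ε) + Real.log (1 - y)) := by
      field_simp
      rw [hu]
      ring
    have h4 : 0 ≤ (r - 1) ^ 2 * (Real.log (1 / ε) + Real.log (1 - y)) :=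
      mul_nonneg (sq_nonneg _) (by linarith)
    have h5 : 0 ≤ r * ((solitonU ε + 1) * degreeDeriv ε y - (solitonU ε - Real.log (1 - y))) :=
      mul_nonneg (by linarith) h1
    exact nonneg_of_mul_nonneg_left (h3 ▸ add_nonneg h5 h4) hupos

/-- For large codes, the expected fraction of batches not hit when `t` batches are processed is
smaller than the fraction of batches not processed, with a margin. -/
theorem exists_exp_neg_hitProb_le {ε : ℝ} (h0 : 0 < ε) (h4 : ε < 1 / 4) :
    ∃ η : ℝ, 0 < η ∧ ∃ M₀ : ℝ, ∀ (m t : ℕ) (N : ℝ), maxDeg ε + 1 ≤ m → M₀ ≤ m →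
      overhead ε * m ≤ N → ε * m - 1 < m - t →
      m * Real.exp (-(N * hitProb (setWeight ε m) t)) ≤ m - t - m * η := by
  obtain ⟨γ, hγ, hmargin⟩ := exists_margin h0 h4
  set r := overhead ε with hr
  have hr1 : 1 < r := one_lt_overhead h0 h4
  set K := degreeDefect ε with hK
  have hK0 : 0 ≤ K := degreeDefect_nonneg h0 h4
  set ρ := Real.exp (-(γ / 2)) with hρ
  have hρ1 : ρ < 1 := by
    rw [hρ, Real.exp_lt_one_iff]
    linarith
  have hρ0 : 0 < ρ := Real.exp_pos _
  have hη : 0 < ε * (1 - ρ) / 2 := by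
    have : 0 < 1 - ρ := by linarith
    positivity
  -- The lower bounds on `m` ensure, in turn, `t < m`, a finite-size defect of at most `γ / 2`, and
  -- `1 ≤ m η`, which absorbs the rounding error of one batch.
  refine ⟨ε * (1 - ρ) / 2, hη,
    max (2 / ε) (max (2 * r * K / γ) (1 / (ε * (1 - ρ) / 2))), ?_⟩
  intro m t N hm hM hN ht
  have hm1 : 2 / ε ≤ m := (le_max_left _ _).trans hM
  have hm2 : 2 * r * K / γ ≤ m := ((le_max_left _ _).trans (le_max_right _ _)).trans hM
  have hm3 : 1 / (ε * (1 - ρ) / 2) ≤ m := ((le_max_right _ _).trans (le_max_right _ _)).trans hM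
  rw [div_le_iff₀ h0] at hm1
  rw [div_le_iff₀ hγ] at hm2
  rw [div_le_iff₀ hη] at hm3
  have hmpos : (0 : ℝ) < m := by
    have : 0 < m := by omega
    exact_mod_cast this
  have htm : t < m := by
    have : (t : ℝ) < m := by linarith
    exact_mod_cast this
  set q := hitProb (setWeight ε m) t with hq
  have hq0 : 0 ≤ q := Finset.sum_nonneg fun j _ =>
    mul_nonneg (Nat.cast_nonneg _) (setWeight_nonneg h0 h4 _ _)
  set y : ℝ := (t : ℝ) / m with hy
  have hty : y * m = t := div_mul_cancel₀ _ hmpos.ne'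
  have hy0 : 0 ≤ y := by positivity
  -- Rounding allows `y` to exceed `1 - ε` by less than `1 / m`, outside the range of the margin;
  -- truncation costs at most one batch.
  set z := min y (1 - ε) with hz
  have hz0 : 0 ≤ z := le_min hy0 (by linarith)
  have hz1 : z ≤ 1 - ε := min_le_right _ _
  have h1 : r * (degreeDeriv ε z - K / m) ≤ N * q := by
    calc r * (degreeDeriv ε z - K / m) ≤ r * (m * q) := by
          refine mul_le_mul_of_nonneg_left ?_ (by linarith)
          refine le_trans ?_ (degreeDeriv_sub_le_mul_hitProb h0 h4 hm htm)
          exact sub_le_sub_right (degreeDeriv_mono h0 h4 hz0 (min_le_left _ _)) _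
      _ = r * m * q := by ring
      _ ≤ N * q := mul_le_mul_of_nonneg_right hN hq0
  have h2 : r * (K / m) ≤ γ / 2 := by
    rw [mul_div_assoc', div_le_iff₀ hmpos]
    linarith
  have h3 := hmargin z hz0 hz1
  have h4 : Real.exp (-(N * q)) ≤ (1 - z) * ρ := by
    rw [hρ, ← Real.exp_log (show 0 < 1 - z by linarith), ← Real.exp_add, Real.exp_le_exp]
    linarith
  have h5 : m * (1 - z) - 1 ≤ m - t := by
    rcases min_choice y (1 - ε) with h | h
    · rw [hz, h]
      linarith
    · rw [hz, h]
      linarith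
  have h6 : m * Real.exp (-(N * q)) ≤ m * ((1 - z) * ρ) := mul_le_mul_of_nonneg_left h4 hmpos.le
  have h7 : m * (ε * (1 - ρ)) ≤ m * ((1 - z) * (1 - ρ)) :=
    mul_le_mul_of_nonneg_left (mul_le_mul_of_nonneg_right (by linarith) (by linarith)) hmpos.le
  linarith

/-- The weight `θ` is chosen equal to the margin `η`. With `log (1 + η) ≥ η - η ^ 2 / 2` the
exponent is at most `(m - t) η ^ 2 / 2 - m η ^ 2`. -/
theorem le_exp_of_mul_pow_le {P p η : ℝ} {m t : ℕ} (hη : 0 < η) (hp : 0 ≤ p)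
    (htm : t ≤ m) (hpm : m * p ≤ m - t - m * η)
    (h : P * (1 + η) ^ (m - t) ≤ (1 + η * p) ^ m) : P ≤ Real.exp (-(m * (η ^ 2 / 2))) := by
  have h1 : (1 + η * p) ^ m ≤ Real.exp (η * (m * p)) := by
    calc (1 + η * p) ^ m ≤ Real.exp (η * p) ^ m :=
          pow_le_pow_left₀ (by positivity) (by linarith [Real.add_one_le_exp (η * p)]) _
      _ = Real.exp (η * (m * p)) := by
          rw [← Real.exp_nat_mul]
          congr 1
          ring
  have h2 : Real.exp ((m - t) * (η - η ^ 2 / 2)) ≤ (1 + η) ^ (m - t) := by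
    have h3 : η - η ^ 2 / 2 ≤ Real.log (1 + η) := by
      refine le_trans ?_ (Real.le_log_one_add_of_nonneg hη.le)
      rw [le_div_iff₀ (by linarith)]
      nlinarith [pow_pos hη 3]
    have h4 : Real.exp (η - η ^ 2 / 2) ≤ 1 + η := by
      rwa [Real.le_log_iff_exp_le (by linarith)] at h3
    calc Real.exp ((m - t) * (η - η ^ 2 / 2)) = Real.exp (η - η ^ 2 / 2) ^ (m - t) := by
          rw [← Real.exp_nat_mul, Nat.cast_sub htm]
      _ ≤ (1 + η) ^ (m - t) := pow_le_pow_left₀ (Real.exp_pos _).le h4 _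
  by_contra! hP
  have hP0 : 0 < P := (Real.exp_pos _).trans hP
  have h5 : Real.exp (-(m * (η ^ 2 / 2))) * Real.exp ((m - t) * (η - η ^ 2 / 2))
      < Real.exp (η * (m * p)) :=
    calc _ < P * Real.exp ((m - t) * (η - η ^ 2 / 2)) :=
          mul_lt_mul_of_pos_right hP (Real.exp_pos _)
      _ ≤ P * (1 + η) ^ (m - t) := mul_le_mul_of_nonneg_left h2 hP0.le
      _ ≤ _ := h.trans h1
  rw [← Real.exp_add, Real.exp_lt_exp] at h5
  have h6 : η * (m * p) ≤ η * (m - t - m * η) := mul_le_mul_of_nonneg_left hpm hη.le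
  have h7 : (0 : ℝ) ≤ t * (η ^ 2 / 2) := by positivity
  nlinarith

end DensityEvolution

/-! ### The batch size -/

section BatchSize

variable {δ : ℝ}

theorem log_one_div_pos (h0 : 0 < δ) (h1 : δ < 1) : 0 < Real.log (1 / δ) :=
  Real.log_pos ((one_lt_div h0).2 h1)

theorem le_batchSize (δ : ℝ) : 1 / Real.log (1 / δ) + 1 ≤ batchSize δ := by
  unfold batchSize
  push_cast
  linarith [Nat.le_ceil (1 / Real.log (1 / δ))]

theorem batchSize_le (h0 : 0 < δ) (h1 : δ < 1) :
    (batchSize δ : ℝ) ≤ 1 / Real.log (1 / δ) + 2 := by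
  have := Nat.ceil_lt_add_one (one_div_nonneg.2 (log_one_div_pos h0 h1).le)
  unfold batchSize
  push_cast
  linarith

theorem batchSize_pos (δ : ℝ) : 0 < batchSize δ := Nat.succ_pos _

theorem one_sub_le_log_one_div (h0 : 0 < δ) : 1 - δ ≤ Real.log (1 / δ) := by
  rw [one_div, Real.log_inv]
  linarith [Real.log_le_sub_one_of_pos h0]

/-- Already `1 / log (1 / δ) + 1` suffices, because `log (1 / δ) < 1 / δ - 1`. Since the overhead
tends to `1` as `ε → 0`, small `ε` are admissible. -/
theorem one_lt_batchSize_mul (h0 : 0 < δ) (h1 : δ < 1) : 1 < batchSize δ * (1 - δ) := by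
  have hL := log_one_div_pos h0 h1
  have h2 : Real.log (1 / δ) < 1 / δ - 1 :=
    Real.log_lt_sub_one_of_pos (by positivity) ((one_lt_div h0).2 h1).ne'
  have h3 : δ * Real.log (1 / δ) < 1 - δ := by
    have := mul_lt_mul_of_pos_left h2 h0
    rwa [mul_sub, mul_one_div_cancel h0.ne', mul_one] at this
  calc (1 : ℝ) < (1 / Real.log (1 / δ) + 1) * (1 - δ) := by
        rw [← sub_pos]
        have : (1 / Real.log (1 / δ) + 1) * (1 - δ) - 1
            = (1 - δ - δ * Real.log (1 / δ)) / Real.log (1 / δ) := by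
          field_simp
          ring
        rw [this]
        exact div_pos (by linarith) hL
    _ ≤ _ := mul_le_mul_of_nonneg_right (le_batchSize δ) (by linarith)

theorem exists_forall_overhead_lt {c : ℝ} (hc : 1 < c) :
    ∃ ε₀ : ℝ, 0 < ε₀ ∧ ∀ ε : ℝ, 0 < ε → ε < ε₀ → ε < 1 / 4 ∧ overhead ε < c := by
  have hpos : 0 < (c - 1) / (4 * c) := div_pos (by linarith) (by linarith)
  refine ⟨(c - 1) / (4 * c), hpos, fun ε h0 h => ?_⟩
  rw [lt_div_iff₀ (by linarith)] at h
  have h4 : ε < 1 / 4 := by nlinarith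
  refine ⟨h4, ?_⟩
  rw [overhead, div_lt_iff₀ (by linarith)]
  linarith

/-- Admissibility bounds the batch size in terms of the error level. -/
theorem batchSize_le_of_overhead_lt {ε : ℝ} (hε0 : 0 < ε) (hε4 : ε < 1 / 4) (h0 : 0 < δ)
    (h1 : δ < 1) (h : overhead ε < batchSize δ * (1 - δ)) :
    (batchSize δ : ℝ) ≤ 2 / (overhead ε - 1) + 2 := by
  have hr := one_lt_overhead hε0 hε4
  have hL := log_one_div_pos h0 h1
  have h2 := one_sub_le_log_one_div h0
  -- Together with admissibility this bounds `1 - δ`, hence `log (1 / δ)`, below by `(overhead ε -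
  -- 1) / 2`.
  have h3 : (batchSize δ : ℝ) * (1 - δ) ≤ 1 + 2 * (1 - δ) := by
    calc (batchSize δ : ℝ) * (1 - δ) ≤ (1 / Real.log (1 / δ) + 2) * (1 - δ) :=
          mul_le_mul_of_nonneg_right (batchSize_le h0 h1) (by linarith)
      _ = (1 - δ) / Real.log (1 / δ) + 2 * (1 - δ) := by ring
      _ ≤ 1 + 2 * (1 - δ) := by
          have := (div_le_one hL).2 h2
          linarith
  have h4 : 1 / Real.log (1 / δ) ≤ 2 / (overhead ε - 1) := by
    rw [div_le_div_iff₀ hL (by linarith)]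
    linarith
  linarith [batchSize_le h0 h1]

end BatchSize

/-! ### The failure probability -/

section Failure

variable {n m b : ℕ} {ε : ℝ}

theorem solitonWeight_one_pos (h0 : 0 < ε) (h4 : ε < 1 / 4) : 0 < solitonWeight ε 1 := by
  have hu : 0 < solitonU ε := by
    rw [solitonU_eq h4]
    have := one_lt_overhead h0 h4
    exact mul_pos (by linarith) (by linarith)
  simp only [solitonWeight, if_true]
  positivity

/-- The failure probability of large codes. -/
theorem exists_exceeds_lt_of_large (h0 : 0 < ε) (h4 : ε < 1 / 4) :
    ∃ κ : ℝ, 0 < κ ∧ ∃ M₀ : ℝ, ∀ (n m b : ℕ) (S : Finset (Fin n)) (hm : maxDeg ε + 1 ≤ m),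
      M₀ ≤ m → b * m ≤ n → n < b * (m + 1) → overhead ε * m ≤ S.card →
      (codeLaw n (solitonPMF m ε h0 h4 hm)).real {I | PeelErrorExceeds ε (ε * n) I S}
        < Real.exp (-(κ * m)) := by
  obtain ⟨η, hη, M₀, hM₀⟩ := exists_exp_neg_hitProb_le h0 h4
  -- Half of the rate `η ^ 2 / 2` absorbs the union bound factor `m + 1`, by the quadratic term of
  -- the exponential series.
  refine ⟨η ^ 2 / 4, by positivity, max M₀ (32 / η ^ 4), ?_⟩
  intro n m b S hm hM hb hn hS
  have hm1 : M₀ ≤ m := (le_max_left _ _).trans hM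
  have hm2 : 32 / η ^ 4 ≤ m := (le_max_right _ _).trans hM
  rw [div_le_iff₀ (by positivity)] at hm2
  have hmpos : (0 : ℝ) < m := by
    have : 0 < m := by omega
    exact_mod_cast this
  have hb0 : (0 : ℝ) < b := by
    have : 0 < b := by
      by_contra hb'
      simp [Nat.eq_zero_of_not_pos hb'] at hn
    exact_mod_cast this
  have hbR : (b : ℝ) * m ≤ n := by exact_mod_cast hb
  have hnR : (n : ℝ) < b * (m + 1) := by exact_mod_cast hn
  have hstuck := codeLaw_real_exceeds_le (c := Real.exp (-(m * (η ^ 2 / 2)))) h0 h4 hm hb S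
    (Real.exp_pos _).le fun t ht hbt => by
      refine le_exp_of_mul_pow_le hη (Real.exp_pos _).le ht ?_
        (codeLaw_real_stuck_le h0 h4 hm S t hη.le)
      refine hM₀ m t S.card hm hm1 hS ?_
      have h1 : b * (ε * m - 1) < b * (m - t : ℝ) := by
        have := mul_le_mul_of_nonneg_left hbR h0.le
        linarith
      exact lt_of_mul_lt_mul_left h1 hb0.le
  refine hstuck.trans_lt ?_
  have h2 := Real.quadratic_le_exp_of_nonneg (show 0 ≤ m * (η ^ 2 / 4) by positivity)
  have h3 : (m : ℝ) + 1 < Real.exp (m * (η ^ 2 / 4)) := by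
    have h5 : (m : ℝ) ≤ (m * (η ^ 2 / 4)) ^ 2 / 2 := by
      have := mul_le_mul_of_nonneg_left hm2 hmpos.le
      linarith
    have h6 : 0 < m * (η ^ 2 / 4) := by positivity
    linarith
  have h7 : Real.exp (-(η ^ 2 / 4 * m))
      = Real.exp (m * (η ^ 2 / 4)) * Real.exp (-(m * (η ^ 2 / 2))) := by
    rw [← Real.exp_add]
    congr 1
    ring
  rw [h7]
  exact mul_lt_mul_of_pos_right h3 (Real.exp_pos _)

/-- The failure probability of small codes is bounded away from one. -/
theorem exists_exceeds_le_of_small (h0 : 0 < ε) (h4 : ε < 1 / 4) (n₀ : ℕ) :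
    ∃ κ : ℝ, 0 < κ ∧ ∀ (n m : ℕ) (S : Finset (Fin n)) (hm : maxDeg ε + 1 ≤ m),
      n ≤ n₀ → m ≤ S.card →
      (codeLaw n (solitonPMF m ε h0 h4 hm)).real {I | PeelErrorExceeds ε (ε * n) I S}
        ≤ 1 - κ := by
  have hp := solitonWeight_one_pos h0 h4
  set a := min (solitonWeight ε 1 / (n₀ + 1)) 1 with ha
  have ha0 : 0 < a := lt_min (by positivity) one_pos
  refine ⟨a ^ n₀, by positivity, ?_⟩
  intro n m S hm hn hS
  refine (codeLaw_real_exceeds_le_one_sub h0 h4 hm S hS).trans (sub_le_sub_left ?_ _)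
  have hmn : m ≤ n₀ := (hS.trans (by simpa using Finset.card_le_univ S)).trans hn
  have hmpos : (0 : ℝ) < m := by
    have : 0 < m := by omega
    exact_mod_cast this
  have haw : a ≤ setWeight ε m 1 := by
    refine (min_le_left _ _).trans ?_
    rw [setWeight, Nat.choose_one_right]
    apply div_le_div_of_nonneg_left hp.le hmpos
    have : (m : ℝ) ≤ n₀ := by exact_mod_cast hmn
    linarith
  exact (pow_le_pow_of_le_one ha0.le (min_le_right _ _) hn).trans (pow_le_pow_left₀ ha0.le haw n)

/-- With `b` bounded, `n` is at most a constant times `m`. If `m` is below the threshold for the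
large-code bound, then `n` is bounded too, and `1 - κ' < 1 - c₀ n ≤ exp (-c₀ n)` for small `c₀`. -/
theorem exists_exceeds_lt (h0 : 0 < ε) (h4 : ε < 1 / 4) (B : ℝ) :
    ∃ c₀ : ℝ, 0 < c₀ ∧ ∀ (n m b : ℕ) (S : Finset (Fin n)) (hm : maxDeg ε + 1 ≤ m),
      (b : ℝ) ≤ B → b * m ≤ n → n < b * (m + 1) → overhead ε * m ≤ S.card →
      (codeLaw n (solitonPMF m ε h0 h4 hm)).real {I | PeelErrorExceeds ε (ε * n) I S}
        < Real.exp (-c₀ * n) := by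
  obtain ⟨κ, hκ, M₀, hlarge⟩ := exists_exceeds_lt_of_large h0 h4
  set B' := max B 1 with hB'
  set M₁ := max M₀ 1 with hM₁
  have hB'1 : 1 ≤ B' := le_max_right _ _
  have hM₁1 : 1 ≤ M₁ := le_max_right _ _
  obtain ⟨κ', hκ', hsmall⟩ := exists_exceeds_le_of_small h0 h4 ⌈B' * (M₁ + 1)⌉₊
  set n₁ : ℝ := ⌈B' * (M₁ + 1)⌉₊ + 1 with hn₁
  have hn₁0 : 0 < n₁ := by positivity
  refine ⟨min (κ / (2 * B')) (κ' / n₁), lt_min (by positivity) (by positivity), ?_⟩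
  intro n m b S hm hbB hb hn hS
  have hm1 : (1 : ℝ) ≤ m := by
    have : 1 ≤ m := by omega
    exact_mod_cast this
  have hnR : (n : ℝ) < b * (m + 1) := by exact_mod_cast hn
  have hnB : (n : ℝ) ≤ B' * (m + 1) :=
    hnR.le.trans (mul_le_mul_of_nonneg_right (hbB.trans (le_max_left _ _)) (by positivity))
  have hn0 : (0 : ℝ) ≤ n := Nat.cast_nonneg n
  rcases le_or_gt M₀ m with hM | hM
  · refine (hlarge n m b S hm hM hb hn hS).trans_le (Real.exp_le_exp.2 ?_)
    have h1 : min (κ / (2 * B')) (κ' / n₁) * n ≤ κ / (2 * B') * (B' * (2 * m)) :=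
      mul_le_mul (min_le_left _ _)
        (hnB.trans (mul_le_mul_of_nonneg_left (by linarith) (by linarith))) hn0 (by positivity)
    have h2 : κ / (2 * B') * (B' * (2 * m)) = κ * m := by
      field_simp
    linarith
  · have hn' : (n : ℝ) ≤ ⌈B' * (M₁ + 1)⌉₊ := by
      refine (hnB.trans (mul_le_mul_of_nonneg_left ?_ (by linarith))).trans (Nat.le_ceil _)
      linarith [le_max_left M₀ 1]
    have hmS : m ≤ S.card := by
      have : (m : ℝ) ≤ S.card := by
        have := one_lt_overhead h0 h4
        nlinarith
      exact_mod_cast this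
    refine (hsmall n m S hm (by exact_mod_cast hn') hmS).trans_lt ?_
    have h1 : min (κ / (2 * B')) (κ' / n₁) * n < κ' := by
      calc min (κ / (2 * B')) (κ' / n₁) * n ≤ κ' / n₁ * n :=
            mul_le_mul_of_nonneg_right (min_le_right _ _) hn0
        _ < κ' / n₁ * n₁ := mul_lt_mul_of_pos_left (by linarith) (by positivity)
        _ = κ' := div_mul_cancel₀ _ hn₁0.ne'
    have := Real.add_one_le_exp (-min (κ / (2 * B')) (κ' / n₁) * n)
    linarith

end Failure

/-! ### The computation load -/

section Load

variable {n m : ℕ} {ε : ℝ}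

theorem averageLoad_le (I : Fin n → Finset (Fin m)) :
    averageLoad (codingMatrix I) ≤ (∑ k, ((I k).card : ℝ)) * ((n / m : ℕ) + 1) / n := by
  unfold averageLoad
  rw [Finset.sum_mul]
  refine div_le_div_of_nonneg_right (Finset.sum_le_sum fun k _ => ?_) (Nat.cast_nonneg n)
  have h1 : (Finset.univ.filter fun j => codingMatrix I k j ≠ 0)
      = (I k).biUnion (batch n m) := by
    ext j
    simp [codingMatrix]
  have h2 : ((I k).biUnion (batch n m)).card ≤ (I k).card * (n / m + 1) :=
    Finset.card_biUnion_le_card_mul _ _ _ fun i _ => card_batch_le i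
  rw [h1]
  exact_mod_cast h2

theorem integral_card (h0 : 0 < ε) (h4 : ε < 1 / 4) (hm : maxDeg ε + 1 ≤ m) (k : Fin n) :
    ∫ I, ((I k).card : ℝ) ∂(codeLaw n (solitonPMF m ε h0 h4 hm)) = degreeDeriv ε 1 := by
  have h1 := Finset.sum_powerset_apply_card (fun d => setWeight ε m d * (d : ℝ))
    (x := (Finset.univ : Finset (Fin m)))
  rw [Finset.powerset_univ, Finset.card_univ, Fintype.card_fin, Finset.sum_range_succ'] at h1
  rw [codeLaw, integral_comp_eval (μ := fun _ => (workerPMF (solitonPMF m ε h0 h4 hm)).toMeasure)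
      (f := fun x : Finset (Fin m) => (x.card : ℝ)) .of_discrete, PMF.integral_eq_sum]
  simp only [workerPMF_toReal, smul_eq_mul, h1, degreeDeriv, one_pow, mul_one, nsmul_eq_mul,
    Nat.cast_zero, mul_zero, add_zero]
  refine ((Finset.sum_subset (Finset.range_subset_range.2 hm) fun d _ hd => ?_).trans
    (Finset.sum_congr rfl fun d hd => ?_)).symm
  · rw [Finset.mem_range] at hd
    rw [solitonWeight_eq_zero h0 h4 (by omega), mul_zero]
  · have : (0 : ℝ) < m.choose (d + 1) := by
      exact_mod_cast Nat.choose_pos (Finset.mem_range.1 hd)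
    rw [setWeight]
    push_cast
    field_simp

/-- The value at `1` is the mean degree, essentially a harmonic sum up to `1 / ε`; additive
constants are absorbed since `1 / ε > 4 > e`. -/
theorem degreeDeriv_one_le (h0 : 0 < ε) (h4 : ε < 1 / 4) :
    degreeDeriv ε 1 ≤ 3 * Real.log (1 / ε) := by
  have hu := solitonU_nonneg h0 h4
  have hD := four_le_maxDeg h0 h4
  have h1 := mul_degreeDeriv h0 h4 1
  have hH : ∑ i ∈ Finset.range (maxDeg ε), (1 : ℝ) ^ (i + 1) / ((i : ℝ) + 1)
      ≤ 1 + Real.log (1 / ε) := by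
    have h2 := harmonic_le_one_add_log (maxDeg ε)
    have h3 : Real.log (maxDeg ε) ≤ Real.log (1 / ε) :=
      Real.log_le_log (by exact_mod_cast (by omega : 0 < maxDeg ε))
        (Nat.floor_le (by positivity))
    have h4 : ((harmonic (maxDeg ε) : ℚ) : ℝ)
        = ∑ i ∈ Finset.range (maxDeg ε), (1 : ℝ) ^ (i + 1) / ((i : ℝ) + 1) := by
      simp [harmonic]
    linarith
  have hL : 1 ≤ Real.log (1 / ε) := by
    rw [Real.le_log_iff_exp_le (by positivity), le_div_iff₀ h0]
    have := Real.exp_one_lt_d9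
    nlinarith [Real.exp_pos 1]
  rw [one_pow] at h1
  have h5 : (solitonU ε + 1) * degreeDeriv ε 1
      ≤ (solitonU ε + 1) * (3 * Real.log (1 / ε)) := by
    nlinarith
  exact le_of_mul_le_mul_left h5 (by linarith)

theorem integral_averageLoad_le (h0 : 0 < ε) (h4 : ε < 1 / 4) (hm : maxDeg ε + 1 ≤ m)
    (hn : 0 < n) :
    ∫ I, averageLoad (codingMatrix I) ∂(codeLaw n (solitonPMF m ε h0 h4 hm))
      ≤ ((n / m : ℕ) + 1) * (3 * Real.log (1 / ε)) := by
  have hnR : (n : ℝ) ≠ 0 := by exact_mod_cast hn.ne'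
  calc ∫ I, averageLoad (codingMatrix I) ∂(codeLaw n (solitonPMF m ε h0 h4 hm))
      ≤ ∫ I, (∑ k, ((I k).card : ℝ)) * ((n / m : ℕ) + 1) / n
          ∂(codeLaw n (solitonPMF m ε h0 h4 hm)) :=
        integral_mono .of_finite .of_finite averageLoad_le
    _ = ((n / m : ℕ) + 1) * degreeDeriv ε 1 := by
        rw [integral_div, integral_mul_const, integral_finsetSum _ fun k _ => .of_finite]
        simp only [integral_card, Finset.sum_const, Finset.card_univ, Fintype.card_fin,
          nsmul_eq_mul]
        field_simp
    _ ≤ _ := mul_le_mul_of_nonneg_left (degreeDeriv_one_le h0 h4) (by positivity)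

end Load

end BatchRaptor

end

/-! ### The theorem -/

theorem mainTheorem4 :
    -- for every straggler fraction, all small error levels are admissible
    (∀ δ : ℝ, 0 < δ → δ < 1 → ∃ ε₀ : ℝ, 0 < ε₀ ∧ ∀ ε : ℝ, 0 < ε → ε < ε₀ →
      ε < 1 / 4 ∧ (1 - 2 * ε) / (1 - 4 * ε) < BatchRaptor.batchSize δ * (1 - δ)) ∧
    -- exponentially small failure probability
    (∀ (ε : ℝ) (h0 : 0 < ε) (h4 : ε < 1 / 4), ∃ c₀ : ℝ, 0 < c₀ ∧
      ∀ (n s : ℕ) (δ : ℝ), 0 < s → s < n → (s : ℝ) = δ * n →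
      (1 - 2 * ε) / (1 - 4 * ε) < BatchRaptor.batchSize δ * (1 - δ) →
      ∀ hm : BatchRaptor.maxDeg ε + 1 ≤ n / BatchRaptor.batchSize δ,
        (BatchRaptor.codeStragglerLaw n s (BatchRaptor.solitonPMF _ ε h0 h4 hm)).real
            {ω | BatchRaptor.PeelErrorExceeds ε (ε * n) ω.1 ω.2} < Real.exp (-c₀ * n) ∧
        (BatchRaptor.codeStragglerLaw n s (BatchRaptor.solitonPMF _ ε h0 h4 hm)).real
            {ω | ε * n < BatchRaptor.err (BatchRaptor.codingMatrix ω.1) ω.2}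
          < Real.exp (-c₀ * n)) ∧
    -- average computation load
    (∀ δ₀ : ℝ, 0 < δ₀ → δ₀ < 1 → ∃ C : ℝ, 0 < C ∧
      ∀ (ε : ℝ) (h0 : 0 < ε) (h4 : ε < 1 / 4) (n s : ℕ) (δ : ℝ),
      s < n → (s : ℝ) = δ * n → δ₀ ≤ δ →
      ∀ hm : BatchRaptor.maxDeg ε + 1 ≤ n / BatchRaptor.batchSize δ,
        ∫ I, BatchRaptor.averageLoad (BatchRaptor.codingMatrix I)
            ∂(BatchRaptor.codeLaw n (BatchRaptor.solitonPMF _ ε h0 h4 hm))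
          ≤ C * (Real.log (1 / ε) / Real.log (1 / δ))) := by
  open MeasureTheory BatchRaptor in
  refine ⟨fun δ hδ0 hδ1 => exists_forall_overhead_lt (one_lt_batchSize_mul hδ0 hδ1), ?_, ?_⟩
  · intro ε h0 h4
    obtain ⟨c₀, hc₀, hlt⟩ := exists_exceeds_lt h0 h4 (2 / (overhead ε - 1) + 2)
    -- Averaging over the received sets gives only `≤`; halving the rate restores strictness.
    refine ⟨c₀ / 2, half_pos hc₀, fun n s δ hs hsn hδ hadm hm => ?_⟩
    have hn : (0 : ℝ) < n := by exact_mod_cast (by omega : 0 < n)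
    have hδ0 : 0 < δ := by
      have : (0 : ℝ) < δ * n := hδ ▸ (by exact_mod_cast hs)
      exact pos_of_mul_pos_left this hn.le
    have hδ1 : δ < 1 := by
      have : δ * n < 1 * n := by
        rw [← hδ, one_mul]
        exact_mod_cast hsn
      exact lt_of_mul_lt_mul_right this hn.le
    set b := batchSize δ with hb
    have hbpos : 0 < b := batchSize_pos δ
    have hbm : b * (n / b) ≤ n := Nat.mul_div_le n b
    have hnb : n < b * (n / b + 1) := Nat.lt_mul_div_succ n hbpos
    have hrows : overhead ε * ((n / b : ℕ) : ℝ) ≤ ((n - s : ℕ) : ℝ) := by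
      have hbR : (0 : ℝ) < b := by exact_mod_cast hbpos
      have h1 : (b : ℝ) * ((n / b : ℕ) : ℝ) ≤ n := by exact_mod_cast hbm
      have hr : 0 < overhead ε := by linarith [one_lt_overhead h0 h4]
      rw [Nat.cast_sub hsn.le, hδ]
      have h2 : overhead ε * (b * ((n / b : ℕ) : ℝ)) ≤ b * (1 - δ) * n :=
        mul_le_mul hadm.le h1 (by positivity) (hr.le.trans hadm.le)
      refine le_of_mul_le_mul_left ?_ hbR
      linarith
    have hexp : Real.exp (-c₀ * n) < Real.exp (-(c₀ / 2) * n) := by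
      rw [Real.exp_lt_exp]
      nlinarith
    have hpeel : (codeStragglerLaw n s (solitonPMF _ ε h0 h4 hm)).real
        {ω | PeelErrorExceeds ε (ε * n) ω.1 ω.2} ≤ Real.exp (-c₀ * n) := by
      refine codeStragglerLaw_real_le _ (PeelErrorExceeds ε (ε * n)) (Real.exp_pos _).le
        fun S hS => (hlt n _ b S hm ?_ hbm hnb (by rw [hS]; exact hrows)).le
      exact batchSize_le_of_overhead_lt h0 h4 hδ0 hδ1 hadm
    refine ⟨hpeel.trans_lt hexp, lt_of_le_of_lt ?_ (hpeel.trans_lt hexp)⟩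
    exact measureReal_mono (fun ω hω => peelErrorExceeds_of_lt_err hω) (measure_ne_top _ _)
  · intro δ₀ hδ₀ hδ₀1
    have hL₀ := log_one_div_pos hδ₀ hδ₀1
    -- The `3` comes from the mean degree. A batch has at most `2 b + 1 ≤ 2 / log (1 / δ) + 5`
    -- blocks, and `1 ≤ log (1 / δ₀) / log (1 / δ)` turns the `5` into the second term.
    refine ⟨3 * (2 + 5 * Real.log (1 / δ₀)), by positivity, ?_⟩
    intro ε h0 h4 n s δ hsn hδ hδδ₀ hm
    have hn : (0 : ℝ) < n := by exact_mod_cast (by omega : 0 < n)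
    have hδ0 : 0 < δ := hδ₀.trans_le hδδ₀
    have hδ1 : δ < 1 := by
      have : δ * n < 1 * n := by
        rw [← hδ, one_mul]
        exact_mod_cast hsn
      exact lt_of_mul_lt_mul_right this hn.le
    have hL := log_one_div_pos hδ0 hδ1
    have hLL₀ : Real.log (1 / δ) ≤ Real.log (1 / δ₀) :=
      Real.log_le_log (by positivity) (one_div_le_one_div_of_le hδ₀ hδδ₀)
    have hlogε : 0 ≤ Real.log (1 / ε) := (log_one_div_pos h0 (by linarith)).le
    refine (integral_averageLoad_le h0 h4 hm (by omega)).trans ?_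
    set b := batchSize δ with hb
    have hbpos : 0 < b := batchSize_pos δ
    have hnb : n < b * (n / b + 1) := Nat.lt_mul_div_succ n hbpos
    have hsize : n / (n / b) ≤ 2 * b := by
      rw [Nat.div_le_iff_le_mul_add_pred (by omega)]
      have : b * 1 ≤ b * (n / b) := Nat.mul_le_mul_left _ (by omega)
      nlinarith
    have hsizeR : ((n / (n / b) : ℕ) : ℝ) ≤ 2 * b := by exact_mod_cast hsize
    have h1 : ((n / (n / b) : ℕ) : ℝ) + 1
        ≤ (2 + 5 * Real.log (1 / δ₀)) / Real.log (1 / δ) := by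
      have h2 := batchSize_le hδ0 hδ1
      have h3 : 1 ≤ Real.log (1 / δ₀) / Real.log (1 / δ) := (one_le_div hL).2 hLL₀
      rw [add_div, mul_div_assoc]
      have h4 : (2 : ℝ) / Real.log (1 / δ) = 2 * (1 / Real.log (1 / δ)) := by ring
      rw [h4]
      linarith
    calc _ ≤ (2 + 5 * Real.log (1 / δ₀)) / Real.log (1 / δ) * (3 * Real.log (1 / ε)) :=
          mul_le_mul_of_nonneg_right h1 (by positivity)
      _ = _ := by ring
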